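/- **Theorem 3.2.** Let $G_1,G_2$ be probability measures on a measurable space $\mathcal X$, let $h:\mathcal X\to\mathbb R^d$ be measurable, and suppose that the density ratio model holds with true parameter $\theta_0=(\alpha_0,\beta_0)\in\mathbb R^{d+1}$: $$\frac{dG_1}{dG_2}(x)=\exp(\alpha_0+\beta_0'h(x)).$$ Let $X_{11},X_{12},\dots$ be i.i.d. with law $G_1$ and $X_{21},X_{22},\dots$ be i.i.d. with law $G_2$, the two sequences being independent. Observe the first $n_1$ variables of the first sequence and the first $n_2$ of the second, put $n=n_1+n_2$, and let $n\to\infty$ in such a way that $n_1/n_2\to\rho_1\in(0,\infty)$. For $\theta=(\alpha,\beta)$ the empirical log-likelihood is $$l(\theta)=-\sum_{i=1}^2\sum_{j=1}^{n_i}\log\Big[1+\frac{n_1}{n_2}e^{\alpha+\beta'h(X_{ij})}\Big]+\sum_{j=1}^{n_1}(\alpha+\beta'h(X_{1j})),$$ and the penalized one is $l_p(\theta)=l(\theta)-\lambda_n J(\beta)$, with the bridge penalty $J(\beta)=\sum_{j=1}^d|\beta_j|^q$, $q>1$, and $\lambda_n\ge 0$. Write $w_\theta(x)=e^{\alpha+\beta'h(x)}$,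 $z(x)=(1,h(x)')'\in\mathbb R^{d+1}$ and $$A=\int \frac{w_{\theta_0}}{1+\rho_1 w_{\theta_0}}\,zz'\,dG_2,\qquad S=\frac{\rho_1}{1+\rho_1}A,\qquad V=\frac{\rho_1}{1+\rho_1}A-\rho_1\,aa',$$ where $a$ is the first column of $A$. Assume the following regularity conditions: $A$ is nonsingular, and the Hessians in $\theta$ of $\log(1+\rho_1 w_\theta(x))$ are dominated near $\theta_0$, that is, there are $r>0$ and a function $K$, integrable under $G_1$ and under $G_2$, with $$\frac{\rho_1 w_\theta(x)}{(1+\rho_1 w_\theta(x))^2}\,\|z(x)\|^2\le K(x)\qquad\text{for all }x\in\mathcal X\text{ and all }\theta\text{ with }\|\theta-\theta_0\|<r.$$ Assume finally that $\lambda_n/\sqrt n\to\lambda_0\ge0$. Then, with probability tending to one, $l_p$ has a unique maximizer over $\mathbb R^{d+1}$; the matrix $\Sigma=S^{-1}VS^{-1}$ is positive semidefinite; and the penalized maximum empirical likelihood estimator $\hat\theta^\lambda$ (any random vector that maximizes $l_p$ with probability tending to one) satisfies $$\sqrt n\,(\hat\theta^\lambda-\theta_0)+\lambda_0S^{-1}b\;\longrightarrow\;\mathcal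 N_{d+1}(0,\,S^{-1}VS^{-1})\quad\text{in distribution},$$ where $b$ is the gradient at $\theta_0$ of $\theta=(\alpha,\beta)\mapsto J(\beta)$, that is $b=(0,\operatorname{sign}(\beta_{0,1})q|\beta_{0,1}|^{q-1},\dots,\operatorname{sign}(\beta_{0,d})q|\beta_{0,d}|^{q-1})'$. In particular, if $\lambda_0=0$, then $\sqrt n\,(\hat\theta^\lambda-\theta_0)\to\mathcal N_{d+1}(0,S^{-1}VS^{-1})$ in distribution. -/

import Mathlib

open MeasureTheory ProbabilityTheory Filter Topology

noncomputable section

namespace DensityRatio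

/-- The parameter space `ℝ^{d+1}`, with its Euclidean norm. A parameter is `θ = (α, β)`:
`θ 0` is the intercept `α` and `θ j.succ` is the coordinate `β_j` of the slope `β ∈ ℝ^d`. -/
abbrev Param (d : ℕ) : Type := EuclideanSpace ℝ (Fin (d + 1))

variable {𝒳 : Type*} {d : ℕ}

/-- The extended vector `z(x) = (1, h(x))` of `ℝ^{d+1}`. -/
def design (h : 𝒳 → Fin d → ℝ) (x : 𝒳) : Param d :=
  WithLp.toLp 2 (Fin.cons 1 (h x))

/-- The linear predictor `α + β' h(x)`. -/
def linPred (h : 𝒳 → Fin d → ℝ) (θ : Param d) (x : 𝒳) : ℝ :=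
  θ 0 + ∑ j : Fin d, θ j.succ * h x j

/-- The density ratio model with parameter `θ = (α, β)`: the law `G₁` has density
`exp (α + β' h(x))` with respect to the law `G₂`. -/
def DensityRatioModel [MeasurableSpace 𝒳] (h : 𝒳 → Fin d → ℝ) (θ : Param d)
    (G₁ G₂ : Measure 𝒳) : Prop :=
  G₁ = G₂.withDensity (fun x => ENNReal.ofReal (Real.exp (linPred h θ x)))

/-- The empirical log-likelihood of `θ` for a first sample `x₁ 0, …, x₁ (m₁ - 1)` and a
second sample `x₂ 0, …, x₂ (m₂ - 1)`, obtained from the nonparametric likelihood by profiling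
out the jumps of `G₂`; the weight in front of the exponential is the ratio `m₁ / m₂` of the
sample sizes. -/
def empLogLik (h : 𝒳 → Fin d → ℝ) (m₁ m₂ : ℕ) (x₁ x₂ : ℕ → 𝒳) (θ : Param d) : ℝ :=
  -(∑ j ∈ Finset.range m₁,
        Real.log (1 + (m₁ : ℝ) / (m₂ : ℝ) * Real.exp (linPred h θ (x₁ j)))
      + ∑ j ∈ Finset.range m₂,
        Real.log (1 + (m₁ : ℝ) / (m₂ : ℝ) * Real.exp (linPred h θ (x₂ j))))
    + ∑ j ∈ Finset.range m₁, linPred h θ (x₁ j)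

/-- The bridge penalty `J(β) = ∑_j |β_j|^q`, as a function of `θ = (α, β)`; the intercept is
not penalized. -/
def bridgePenalty (q : ℝ) (θ : Param d) : ℝ :=
  ∑ j : Fin d, |θ j.succ| ^ q

/-- The penalized empirical log-likelihood `l_p(θ) = l(θ) - lam * J(β)`. -/
def penLogLik (h : 𝒳 → Fin d → ℝ) (q lam : ℝ) (m₁ m₂ : ℕ) (x₁ x₂ : ℕ → 𝒳)
    (θ : Param d) : ℝ :=
  empLogLik h m₁ m₂ x₁ x₂ θ - lam * bridgePenalty q θ

/-- `θ` is a (global) maximizer of the penalized empirical log-likelihood. -/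
def IsPenMaximizer (h : 𝒳 → Fin d → ℝ) (q lam : ℝ) (m₁ m₂ : ℕ) (x₁ x₂ : ℕ → 𝒳)
    (θ : Param d) : Prop :=
  ∀ θ' : Param d, penLogLik h q lam m₁ m₂ x₁ x₂ θ' ≤ penLogLik h q lam m₁ m₂ x₁ x₂ θ

/-- The matrix `A = ∫ w / (1 + ρ w) z z' dG₂` with `z = (1, h(x))` and
`w = exp (α + β' h(x))`. -/
def matA [MeasurableSpace 𝒳] (h : 𝒳 → Fin d → ℝ) (ρ : ℝ) (θ : Param d) (G₂ : Measure 𝒳) :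
    Matrix (Fin (d + 1)) (Fin (d + 1)) ℝ :=
  Matrix.of fun i j =>
    ∫ x, Real.exp (linPred h θ x) / (1 + ρ * Real.exp (linPred h θ x))
      * (design h x i * design h x j) ∂G₂

/-- The matrix `S = ρ / (1 + ρ) A`. -/
def matS [MeasurableSpace 𝒳] (h : 𝒳 → Fin d → ℝ) (ρ : ℝ) (θ : Param d) (G₂ : Measure 𝒳) :
    Matrix (Fin (d + 1)) (Fin (d + 1)) ℝ :=
  (ρ / (1 + ρ)) • matA h ρ θ G₂

/-- The matrix `V = ρ / (1 + ρ) A - ρ a a'`, where `a` is the first column of the symmetric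
matrix `A`. -/
def matV [MeasurableSpace 𝒳] (h : 𝒳 → Fin d → ℝ) (ρ : ℝ) (θ : Param d) (G₂ : Measure 𝒳) :
    Matrix (Fin (d + 1)) (Fin (d + 1)) ℝ :=
  (ρ / (1 + ρ)) • matA h ρ θ G₂
    - ρ • Matrix.vecMulVec (fun i => matA h ρ θ G₂ i 0) (fun j => matA h ρ θ G₂ 0 j)

/-- The asymptotic covariance matrix `Σ = S⁻¹ V S⁻¹`. -/
def asympCov [MeasurableSpace 𝒳] (h : 𝒳 → Fin d → ℝ) (ρ : ℝ) (θ : Param d) (G₂ : Measure 𝒳) :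
    Matrix (Fin (d + 1)) (Fin (d + 1)) ℝ :=
  (matS h ρ θ G₂)⁻¹ * matV h ρ θ G₂ * (matS h ρ θ G₂)⁻¹

/-- The standard regularity condition on the likelihood: on a neighbourhood of `θ₀` the second
derivatives in `θ` of the contribution `log (1 + ρ exp (α + β' h(x)))` of one observation are
dominated by a function of `x` that is integrable under both laws. The Hessian of this
contribution is `ρ w / (1 + ρ w)² z z'` with `z = (1, h(x))`, `w = exp (α + β' h(x))`, and
`‖z‖² ρ w / (1 + ρ w)²` is its norm. -/
def DominatedHessian [MeasurableSpace 𝒳] (h : 𝒳 → Fin d → ℝ) (ρ : ℝ) (θ₀ : Param d)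
    (G₁ G₂ : Measure 𝒳) : Prop :=
  ∃ r : ℝ, 0 < r ∧ ∃ K : 𝒳 → ℝ, Integrable K G₁ ∧ Integrable K G₂ ∧
    ∀ θ ∈ Metric.ball θ₀ r, ∀ x : 𝒳,
      ρ * Real.exp (linPred h θ x) / (1 + ρ * Real.exp (linPred h θ x)) ^ 2
        * ‖design h x‖ ^ 2 ≤ K x

end DensityRatio

end

noncomputable section

namespace DensityRatio

/-- The function `log (1 + e ^ t)`, whose derivative is the sigmoid function. -/
def softplus (t : ℝ) : ℝ := Real.log (1 + Real.exp t)

/-- The derivative of the sigmoid function. -/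
def sigmoidDeriv (t : ℝ) : ℝ := Real.sigmoid t * (1 - Real.sigmoid t)

lemma sigmoid_eq_exp_div (t : ℝ) : Real.sigmoid t = Real.exp t / (1 + Real.exp t) := by
  rw [Real.sigmoid_def, Real.exp_neg]
  have := Real.exp_pos t
  field_simp
  ring

lemma one_sub_sigmoid_eq (t : ℝ) : 1 - Real.sigmoid t = 1 / (1 + Real.exp t) := by
  rw [sigmoid_eq_exp_div]
  have := Real.exp_pos t
  field_simp
  ring

lemma sigmoidDeriv_eq (t : ℝ) : sigmoidDeriv t = Real.exp t / (1 + Real.exp t) ^ 2 := by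
  rw [sigmoidDeriv, one_sub_sigmoid_eq, sigmoid_eq_exp_div]
  have := Real.exp_pos t
  field_simp

lemma sigmoidDeriv_pos (t : ℝ) : 0 < sigmoidDeriv t := by
  rw [sigmoidDeriv_eq]; positivity

lemma sigmoidDeriv_le_one (t : ℝ) : sigmoidDeriv t ≤ 1 := by
  have h₁ := Real.sigmoid_nonneg t
  have h₂ := Real.sigmoid_le_one t
  rw [sigmoidDeriv]; nlinarith

lemma continuous_sigmoidDeriv : Continuous sigmoidDeriv := by
  unfold sigmoidDeriv
  have : Continuous Real.sigmoid :=
    continuous_iff_continuousAt.2 fun t => (Real.hasDerivAt_sigmoid t).continuousAt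
  fun_prop

lemma hasDerivAt_softplus (t : ℝ) : HasDerivAt softplus (Real.sigmoid t) t := by
  have h := ((Real.hasDerivAt_exp t).const_add 1).log (by positivity)
  rwa [← sigmoid_eq_exp_div] at h

lemma hasDerivAt_sigmoid (t : ℝ) : HasDerivAt Real.sigmoid (sigmoidDeriv t) t :=
  Real.hasDerivAt_sigmoid t

lemma exp_mul_add_log {ρ : ℝ} (hρ : 0 < ρ) (s : ℝ) :
    ρ * Real.exp s = Real.exp (s + Real.log ρ) := by
  rw [Real.exp_add, Real.exp_log hρ, mul_comm]

lemma log_one_add_mul_exp {ρ : ℝ} (hρ : 0 < ρ) (s : ℝ) :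
    Real.log (1 + ρ * Real.exp s) = softplus (s + Real.log ρ) := by
  rw [exp_mul_add_log hρ, softplus]

lemma sigmoidDeriv_add_le (t y : ℝ) :
    sigmoidDeriv (t + y) ≤ Real.exp |y| * sigmoidDeriv t := by
  rw [sigmoidDeriv_eq, sigmoidDeriv_eq, Real.exp_add, mul_div_assoc',
    div_le_div_iff₀ (by positivity) (by positivity)]
  have ha := Real.exp_pos t
  have hb := Real.exp_pos y
  set a := Real.exp t
  rcases le_total 0 y with hy | hy
  · rw [abs_of_nonneg hy]
    have h1 : 1 ≤ Real.exp y := Real.one_le_exp hy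
    have h2 : (1 + a) ^ 2 ≤ (1 + a * Real.exp y) ^ 2 := by gcongr; nlinarith
    have := mul_le_mul_of_nonneg_left h2 (mul_pos ha hb).le
    linarith
  · rw [abs_of_nonpos hy, Real.exp_neg]
    set b := Real.exp y
    have h1 : b ≤ 1 := Real.exp_le_one_iff.2 hy
    have h2 : (b * (1 + a)) ^ 2 ≤ (1 + a * b) ^ 2 := by gcongr; nlinarith
    have h3 : b⁻¹ * a * (b * (1 + a)) ^ 2 ≤ b⁻¹ * a * (1 + a * b) ^ 2 := by gcongr
    calc a * b * (1 + a) ^ 2 = b⁻¹ * a * (b * (1 + a)) ^ 2 := by field_simp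
      _ ≤ _ := h3

lemma abs_sigmoidDeriv_add_sub_le (t y : ℝ) :
    |sigmoidDeriv (t + y) - sigmoidDeriv t| ≤ (Real.exp |y| - 1) * sigmoidDeriv t := by
  have h1 := sigmoidDeriv_add_le t y
  have h2 := sigmoidDeriv_add_le (t + y) (-y)
  rw [add_neg_cancel_right, abs_neg] at h2
  have hp := sigmoidDeriv_pos t
  set E := Real.exp |y| with hE
  have hE1 : 1 ≤ E := Real.one_le_exp (abs_nonneg y)
  rw [abs_le]
  constructor
  · have h3 : E⁻¹ * sigmoidDeriv t ≤ sigmoidDeriv (t + y) := by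
      rw [inv_mul_le_iff₀ (by positivity)]; exact h2
    have h4 : 2 - E ≤ E⁻¹ := by
      rw [← sub_nonneg]
      have : E⁻¹ - (2 - E) = (E - 1) ^ 2 / E := by field_simp; ring
      rw [this]; positivity
    nlinarith [mul_le_mul_of_nonneg_right h4 hp.le]
  · linarith

lemma abs_sigmoid_add_sub_le (t y : ℝ) :
    |Real.sigmoid (t + y) - Real.sigmoid t| ≤ |y| * Real.exp |y| * sigmoidDeriv t := by
  have h := Convex.norm_image_sub_le_of_norm_hasDerivWithin_le (f := Real.sigmoid)
    (f' := sigmoidDeriv) (s := Set.uIcc t (t + y)) (C := Real.exp |y| * sigmoidDeriv t)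
    (x := t) (y := t + y)
    (fun x _ => (hasDerivAt_sigmoid x).hasDerivWithinAt) (fun x hx => ?_)
    (convex_uIcc _ _) Set.left_mem_uIcc Set.right_mem_uIcc
  · simpa [mul_comm, mul_assoc, mul_left_comm] using h
  · rw [Real.norm_of_nonneg (sigmoidDeriv_pos x).le]
    have h1 := sigmoidDeriv_add_le t (x - t)
    rw [add_sub_cancel] at h1
    have h2 : |x - t| ≤ |y| := by simpa using Set.abs_sub_left_of_mem_uIcc hx
    exact h1.trans (by have := (sigmoidDeriv_pos t).le; gcongr)

/-- Second order Taylor estimate with an approximate second derivative `m`. -/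
lemma abs_taylor_remainder_le {f f' f'' : ℝ → ℝ} (hf : ∀ x, HasDerivAt f (f' x) x)
    (hf' : ∀ x, HasDerivAt f' (f'' x) x) {t v m M : ℝ}
    (hM : ∀ w, |w| ≤ |v| → |f'' (t + w) - m| ≤ M) :
    |f (t + v) - f t - f' t * v - m * v ^ 2 / 2| ≤ M * v ^ 2 := by
  have hmem : ∀ x ∈ Set.uIcc 0 v, |x| ≤ |v| := fun x hx => by
    simpa using Set.abs_sub_left_of_mem_uIcc hx
  have hM0 : 0 ≤ M := (abs_nonneg _).trans (hM 0 (by simp))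
  have h1 : ∀ x ∈ Set.uIcc 0 v, |f' (t + x) - f' t - m * x| ≤ M * |v| := by
    intro x hx
    have h := Convex.norm_image_sub_le_of_norm_hasDerivWithin_le
      (f := fun x => f' (t + x) - f' t - m * x)
      (f' := fun x => f'' (t + x) - m) (s := Set.uIcc 0 v) (C := M) (x := 0) (y := x)
      (fun y _ => ?_) (fun y hy => hM y (hmem y hy))
      (convex_uIcc _ _) Set.left_mem_uIcc hx
    · simp only [add_zero, sub_self, mul_zero, sub_zero, Real.norm_eq_abs] at h
      exact h.trans (mul_le_mul_of_nonneg_left (hmem x hx) hM0)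
    · have h2 := ((hf' (t + y)).comp_const_add t y).sub_const (f' t)
      have h3 : HasDerivAt (fun x => f' (t + x) - f' t - m * x) (f'' (t + y) - m * 1) y :=
        h2.sub ((hasDerivAt_id y).const_mul m)
      rw [mul_one] at h3
      exact h3.hasDerivWithinAt
  have h := Convex.norm_image_sub_le_of_norm_hasDerivWithin_le
      (f := fun x => f (t + x) - f t - f' t * x - m * x ^ 2 / 2)
      (f' := fun x => f' (t + x) - f' t - m * x) (s := Set.uIcc 0 v) (C := M * |v|)
      (x := 0) (y := v) (fun y _ => ?_) (fun y hy => h1 y hy)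
      (convex_uIcc _ _) Set.left_mem_uIcc Set.right_mem_uIcc
  · simp only [add_zero, sub_self, mul_zero, sub_zero, Real.norm_eq_abs, ne_eq,
      OfNat.ofNat_ne_zero, not_false_eq_true, zero_pow, zero_div] at h
    rwa [mul_assoc, ← abs_mul, ← sq, abs_sq] at h
  · have h2 := ((hf (t + y)).comp_const_add t y).sub_const (f t)
    have h3 : HasDerivAt (fun x => f (t + x) - f t - f' t * x - m * x ^ 2 / 2)
        (f' (t + y) - f' t * 1 - m * ((2 : ℕ) * y ^ (2 - 1)) / 2) y :=
      (h2.sub ((hasDerivAt_id y).const_mul (f' t))).sub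
        (((hasDerivAt_pow 2 y).const_mul m).div_const 2)
    have h4 : f' (t + y) - f' t * 1 - m * ((2 : ℕ) * y ^ (2 - 1)) / 2 = f' (t + y) - f' t - m * y := by
      push_cast; ring
    rw [h4] at h3
    exact h3.hasDerivWithinAt

lemma strictConvexOn_softplus : StrictConvexOn ℝ Set.univ softplus := by
  refine StrictMono.strictConvexOn_univ_of_deriv ?_ ?_
  · exact continuous_iff_continuousAt.2 fun t => (hasDerivAt_softplus t).continuousAt
  · have : deriv softplus = Real.sigmoid := funext fun t => (hasDerivAt_softplus t).deriv
    rw [this]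
    exact Real.sigmoid_strictMono

lemma continuous_softplus : Continuous softplus :=
  continuous_iff_continuousAt.2 fun t => (hasDerivAt_softplus t).continuousAt

section Deterministic

variable {𝒳 : Type*} {d : ℕ} (h : 𝒳 → Fin d → ℝ)

lemma design_apply_zero (x : 𝒳) : design h x 0 = 1 := rfl

lemma linPred_eq_inner (θ : Param d) (x : 𝒳) : linPred h θ x = inner ℝ θ (design h x) := by
  rw [linPred, PiLp.inner_apply, Fin.sum_univ_succ]
  simp [design, mul_comm]

lemma one_le_norm_design (x : 𝒳) : 1 ≤ ‖design h x‖ := by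
  simpa [design_apply_zero] using PiLp.norm_apply_le (design h x) 0

/-- The sum of `f₁` over the first sample plus the sum of `f₂` over the second sample. -/
def sampleSum {M : Type*} [AddCommMonoid M] (f₁ f₂ : 𝒳 → M) (m₁ m₂ : ℕ) (x₁ x₂ : ℕ → 𝒳) : M :=
  ∑ j ∈ Finset.range m₁, f₁ (x₁ j) + ∑ j ∈ Finset.range m₂, f₂ (x₂ j)

/-- The gradient of the empirical log-likelihood, with the sample ratio `m₁ / m₂` replaced by
`exp γ`. -/
def score (θ : Param d) (γ : ℝ) (m₁ m₂ : ℕ) (x₁ x₂ : ℕ → 𝒳) : Param d :=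
  sampleSum (fun x => (1 - Real.sigmoid (linPred h θ x + γ)) • design h x)
    (fun x => -(Real.sigmoid (linPred h θ x + γ) • design h x)) m₁ m₂ x₁ x₂

/-- A bound for the variation of the Hessian of one observation when the linear predictor moves
by at most `δ ‖z‖`. -/
def hessianModulus (K : 𝒳 → ℝ) (δ : ℝ) (x : 𝒳) : ℝ :=
  min ((Real.exp (δ * ‖design h x‖) - 1) * K x) (2 * K x)

lemma empLogLik_eq_sampleSum {m₁ m₂ : ℕ} (h₁ : 0 < m₁) (h₂ : 0 < m₂) (x₁ x₂ : ℕ → 𝒳)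
    (θ : Param d) :
    empLogLik h m₁ m₂ x₁ x₂ θ =
      sampleSum (fun x => linPred h θ x - softplus (linPred h θ x + Real.log (m₁ / m₂)))
        (fun x => -softplus (linPred h θ x + Real.log (m₁ / m₂))) m₁ m₂ x₁ x₂ := by
  have hρ : (0 : ℝ) < (m₁ : ℝ) / m₂ := by positivity
  simp only [empLogLik, sampleSum, log_one_add_mul_exp hρ, Finset.sum_sub_distrib,
    Finset.sum_neg_distrib]
  ring

variable {h} {θ₀ : Param d} {c r : ℝ} {K : 𝒳 → ℝ}

lemma abs_sigmoidDeriv_sub_mul_le_hessianModulus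
    (hK : ∀ θ ∈ Metric.ball θ₀ r, ∀ x,
      sigmoidDeriv (linPred h θ x + c) * ‖design h x‖ ^ 2 ≤ K x)
    {δ y : ℝ} (hδ : δ < r) (hδ0 : 0 ≤ δ) {x : 𝒳} (hy : |y| ≤ δ * ‖design h x‖) :
    |sigmoidDeriv (linPred h θ₀ x + c + y) - sigmoidDeriv (linPred h θ₀ x + c)|
      * ‖design h x‖ ^ 2 ≤ hessianModulus h K δ x := by
  have hz := one_le_norm_design h x
  set z := design h x with hzdef
  have h0 : sigmoidDeriv (linPred h θ₀ x + c) * ‖z‖ ^ 2 ≤ K x :=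
    hK θ₀ (Metric.mem_ball_self (hδ0.trans_lt hδ)) x
  have hp := sigmoidDeriv_pos (linPred h θ₀ x + c)
  refine le_min ?_ ?_
  · have h1 := abs_sigmoidDeriv_add_sub_le (linPred h θ₀ x + c) y
    have h2 : Real.exp |y| ≤ Real.exp (δ * ‖z‖) := Real.exp_le_exp.2 hy
    have h3 : 0 ≤ Real.exp (δ * ‖z‖) - 1 := by
      have := Real.one_le_exp (show 0 ≤ δ * ‖z‖ by positivity); linarith
    calc _ ≤ (Real.exp (δ * ‖z‖) - 1) * sigmoidDeriv (linPred h θ₀ x + c) * ‖z‖ ^ 2 := by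
          gcongr; exact h1.trans (by gcongr)
      _ = (Real.exp (δ * ‖z‖) - 1) * (sigmoidDeriv (linPred h θ₀ x + c) * ‖z‖ ^ 2) := by ring
      _ ≤ _ := by gcongr
  · have h1 : linPred h (θ₀ + (y / ‖z‖ ^ 2) • z) x = linPred h θ₀ x + y := by
      rw [linPred_eq_inner, linPred_eq_inner, inner_add_left, real_inner_smul_left, ← hzdef,
        real_inner_self_eq_norm_sq]
      field_simp
    have h2 : θ₀ + (y / ‖z‖ ^ 2) • z ∈ Metric.ball θ₀ r := by
      rw [mem_ball_iff_norm, add_sub_cancel_left, norm_smul, Real.norm_eq_abs, abs_div,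
        abs_of_nonneg (sq_nonneg ‖z‖)]
      have : |y| / ‖z‖ ^ 2 * ‖z‖ = |y| / ‖z‖ := by field_simp
      rw [this]
      refine lt_of_le_of_lt ?_ hδ
      rw [div_le_iff₀ (by positivity)]; exact hy
    have h3 := hK _ h2 x
    rw [h1, add_right_comm] at h3
    have hp' := sigmoidDeriv_pos (linPred h θ₀ x + c + y)
    have h4 : |sigmoidDeriv (linPred h θ₀ x + c + y) - sigmoidDeriv (linPred h θ₀ x + c)| ≤
      sigmoidDeriv (linPred h θ₀ x + c + y) + sigmoidDeriv (linPred h θ₀ x + c) := by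
      rw [abs_le]; constructor <;> linarith
    calc _ ≤ (sigmoidDeriv (linPred h θ₀ x + c + y) + sigmoidDeriv (linPred h θ₀ x + c))
        * ‖z‖ ^ 2 := by gcongr
      _ ≤ _ := by rw [add_mul, two_mul]; gcongr

lemma abs_softplus_expansion_le
    (hK : ∀ θ ∈ Metric.ball θ₀ r, ∀ x,
      sigmoidDeriv (linPred h θ x + c) * ‖design h x‖ ^ 2 ≤ K x)
    {δ γ s : ℝ} (hδ : δ < r) (hs : 0 ≤ s) {u : Param d} (hu : |γ - c| + s * ‖u‖ ≤ δ) (x : 𝒳) :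
    |softplus (linPred h (θ₀ + s • u) x + γ) - softplus (linPred h θ₀ x + γ)
      - Real.sigmoid (linPred h θ₀ x + γ) * (s * inner ℝ u (design h x))
      - sigmoidDeriv (linPred h θ₀ x + c) * (s * inner ℝ u (design h x)) ^ 2 / 2|
      ≤ hessianModulus h K δ x * (s ^ 2 * ‖u‖ ^ 2) := by
  have hz := one_le_norm_design h x
  have hδ0 : 0 ≤ δ := le_trans (by positivity) hu
  set z := design h x with hzdef
  have hv : |s * inner ℝ u z| ≤ s * ‖u‖ * ‖z‖ := by
    rw [abs_mul, abs_of_nonneg hs, mul_assoc]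
    gcongr
    exact abs_real_inner_le_norm u z
  have key := abs_taylor_remainder_le hasDerivAt_softplus hasDerivAt_sigmoid
    (t := linPred h θ₀ x + γ) (v := s * inner ℝ u z)
    (m := sigmoidDeriv (linPred h θ₀ x + c)) (M := hessianModulus h K δ x / ‖z‖ ^ 2)
    (fun w hw => by
      rw [le_div_iff₀ (by positivity)]
      have h1 : linPred h θ₀ x + γ + w = linPred h θ₀ x + c + (γ - c + w) := by ring
      rw [h1]
      refine abs_sigmoidDeriv_sub_mul_le_hessianModulus hK hδ hδ0 ?_
      calc |γ - c + w| ≤ |γ - c| + |w| := abs_add_le _ _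
        _ ≤ |γ - c| * ‖z‖ + s * ‖u‖ * ‖z‖ := by
          gcongr
          · exact le_mul_of_one_le_right (abs_nonneg _) hz
          · exact hw.trans hv
        _ = (|γ - c| + s * ‖u‖) * ‖z‖ := by ring
        _ ≤ _ := by gcongr)
  have h2 : linPred h (θ₀ + s • u) x + γ = linPred h θ₀ x + γ + s * inner ℝ u z := by
    rw [linPred_eq_inner, linPred_eq_inner, inner_add_left, real_inner_smul_left]; ring
  rw [h2]
  refine key.trans ?_
  have hD : 0 ≤ hessianModulus h K δ x := by
    have := abs_sigmoidDeriv_sub_mul_le_hessianModulus hK hδ hδ0 (x := x) (y := 0)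
      (by simp; positivity)
    exact le_trans (by positivity) this
  have h3 : (s * inner ℝ u z) ^ 2 ≤ (s * ‖u‖ * ‖z‖) ^ 2 := sq_le_sq' (abs_le.1 hv).1 (abs_le.1 hv).2
  calc _ ≤ hessianModulus h K δ x / ‖z‖ ^ 2 * (s * ‖u‖ * ‖z‖) ^ 2 := by gcongr
    _ = _ := by field_simp

lemma abs_empLogLik_expansion_le
    (hK : ∀ θ ∈ Metric.ball θ₀ r, ∀ x,
      sigmoidDeriv (linPred h θ x + c) * ‖design h x‖ ^ 2 ≤ K x)
    {m₁ m₂ : ℕ} (h₁ : 0 < m₁) (h₂ : 0 < m₂) (x₁ x₂ : ℕ → 𝒳)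
    {δ s : ℝ} (hδ : δ < r) (hs : 0 ≤ s) {u : Param d}
    (hu : |Real.log (m₁ / m₂) - c| + s * ‖u‖ ≤ δ) :
    |empLogLik h m₁ m₂ x₁ x₂ (θ₀ + s • u) - empLogLik h m₁ m₂ x₁ x₂ θ₀
      - s * inner ℝ u (score h θ₀ (Real.log (m₁ / m₂)) m₁ m₂ x₁ x₂)
      + s ^ 2 / 2 * sampleSum (fun x => sigmoidDeriv (linPred h θ₀ x + c)
          * inner ℝ u (design h x) ^ 2) (fun x => sigmoidDeriv (linPred h θ₀ x + c)
          * inner ℝ u (design h x) ^ 2) m₁ m₂ x₁ x₂|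
      ≤ s ^ 2 * ‖u‖ ^ 2 *
        sampleSum (hessianModulus h K δ) (hessianModulus h K δ) m₁ m₂ x₁ x₂ := by
  rw [empLogLik_eq_sampleSum h h₁ h₂, empLogLik_eq_sampleSum h h₁ h₂]
  set γ := Real.log (m₁ / m₂)
  set e : 𝒳 → ℝ := fun x =>
    softplus (linPred h (θ₀ + s • u) x + γ) - softplus (linPred h θ₀ x + γ)
      - Real.sigmoid (linPred h θ₀ x + γ) * (s * inner ℝ u (design h x))
      - sigmoidDeriv (linPred h θ₀ x + c) * (s * inner ℝ u (design h x)) ^ 2 / 2 with he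
  have hb : ∀ x, |e x| ≤ s ^ 2 * ‖u‖ ^ 2 * hessianModulus h K δ x := fun x => by
    rw [mul_comm]; exact abs_softplus_expansion_le hK hδ hs hu x
  have hlin : ∀ x, linPred h (θ₀ + s • u) x = linPred h θ₀ x + s * inner ℝ u (design h x) :=
    fun x => by rw [linPred_eq_inner, linPred_eq_inner, inner_add_left, real_inner_smul_left]
  calc _ = |sampleSum e e m₁ m₂ x₁ x₂| := by
        rw [← abs_neg]
        congr 1
        simp only [sampleSum, score, inner_add_right, inner_sum, Finset.mul_sum, mul_add,
          inner_smul_right, inner_neg_right]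
        rw [← sub_eq_zero]
        have : ∀ A₁ A₂ B₁ B₂ C₁ C₂ D₁ D₂ E₁ E₂ : ℝ,
            -(A₁ + A₂ - (B₁ + B₂) - (C₁ + C₂) + (D₁ + D₂)) - (E₁ + E₂) =
            -(A₁ - B₁ - C₁ + D₁ + E₁) - (A₂ - B₂ - C₂ + D₂ + E₂) := by intros; ring
        rw [this]
        simp only [← Finset.sum_add_distrib, ← Finset.sum_sub_distrib]
        rw [Finset.sum_eq_zero, Finset.sum_eq_zero]
        · simp
        · intro j _
          simp only [he]; ring
        · intro j _
          simp only [he, hlin]; ring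
    _ ≤ ∑ j ∈ Finset.range m₁, |e (x₁ j)| + ∑ j ∈ Finset.range m₂, |e (x₂ j)| :=
        (abs_add_le _ _).trans (add_le_add (Finset.abs_sum_le_sum_abs _ _)
          (Finset.abs_sum_le_sum_abs _ _))
    _ ≤ _ := by
        rw [sampleSum, mul_add, Finset.mul_sum, Finset.mul_sum]
        gcongr <;> exact hb _

end Deterministic

/-- A concave function that is smaller on a sphere than at its center attains its maximum, and
all its maximizers lie in the ball. -/
lemma exists_max_of_lt_on_sphere {E : Type*} [NormedAddCommGroup E] [NormedSpace ℝ E]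
    [FiniteDimensional ℝ E] {f : E → ℝ} (hf : ConcaveOn ℝ Set.univ f) (hc : Continuous f)
    {a : E} {ε : ℝ} (hε : 0 < ε) (hlt : ∀ u, ‖u - a‖ = ε → f u < f a) :
    (∃ u, ∀ v, f v ≤ f u) ∧ ∀ u, (∀ v, f v ≤ f u) → ‖u - a‖ < ε := by
  have hout : ∀ u, ε ≤ ‖u - a‖ → f u < f a := by
    intro u hu
    have hpos : 0 < ‖u - a‖ := hε.trans_le hu
    set t := ε / ‖u - a‖ with ht
    have ht0 : 0 < t := by positivity
    have ht1 : t ≤ 1 := (div_le_one hpos).2 hu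
    have h1 := hf.2 (Set.mem_univ a) (Set.mem_univ u) (sub_nonneg.2 ht1) ht0.le (by ring)
    have h2 := hlt ((1 - t) • a + t • u) (by
      have : (1 - t) • a + t • u - a = t • (u - a) := by module
      rw [this, norm_smul, Real.norm_of_nonneg ht0.le, ht]; field_simp)
    have h3 := h1.trans_lt h2
    simp only [smul_eq_mul] at h3
    have h4 : t * f u < t * f a := by linarith
    exact lt_of_mul_lt_mul_left h4 ht0.le
  refine ⟨?_, fun u hu => ?_⟩
  · obtain ⟨u, hu, hmax⟩ := (isCompact_closedBall a ε).exists_isMaxOn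
      ⟨a, Metric.mem_closedBall_self hε.le⟩ hc.continuousOn
    refine ⟨u, fun v => ?_⟩
    by_cases hv : ‖v - a‖ ≤ ε
    · exact hmax (mem_closedBall_iff_norm.2 hv)
    · exact (hout v (not_le.1 hv).le).le.trans (hmax (Metric.mem_closedBall_self hε.le))
  · by_contra! hcon
    exact absurd (hu a) (not_le.2 (hout u hcon))

section Concavity

variable {𝒳 : Type*} {d : ℕ} {h : 𝒳 → Fin d → ℝ}

lemma linPred_add_smul (a b : ℝ) (θ θ' : Param d) (x : 𝒳) :
    linPred h (a • θ + b • θ') x = a * linPred h θ x + b * linPred h θ' x := by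
  simp only [linPred_eq_inner, inner_add_left, real_inner_smul_left]

lemma continuous_linPred (x : 𝒳) : Continuous fun θ : Param d => linPred h θ x := by
  simp only [linPred_eq_inner]; fun_prop

lemma continuous_bridgePenalty {q : ℝ} (hq : 1 < q) :
    Continuous (bridgePenalty q : Param d → ℝ) := by
  unfold bridgePenalty
  refine continuous_finsetSum _ fun j _ => ?_
  exact Continuous.rpow_const (by fun_prop) fun _ => Or.inr (by linarith)

lemma convexOn_bridgePenalty {q : ℝ} (hq : 1 < q) :
    ConvexOn ℝ Set.univ (bridgePenalty q : Param d → ℝ) := by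
  refine ⟨convex_univ, fun θ _ θ' _ a b ha hb hab => ?_⟩
  simp only [bridgePenalty, smul_eq_mul, Finset.mul_sum]
  rw [← Finset.sum_add_distrib]
  refine Finset.sum_le_sum fun j _ => ?_
  have h1 := (convexOn_rpow hq.le).2 (Set.mem_Ici.2 (abs_nonneg (θ j.succ)))
    (Set.mem_Ici.2 (abs_nonneg (θ' j.succ))) ha hb hab
  refine le_trans (Real.rpow_le_rpow (abs_nonneg _) ?_ (by linarith)) h1
  simp only [PiLp.add_apply, PiLp.smul_apply, smul_eq_mul]
  refine (abs_add_le _ _).trans ?_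
  rw [abs_mul, abs_mul, abs_of_nonneg ha, abs_of_nonneg hb]

lemma differentiable_bridgePenalty {q : ℝ} (hq : 1 < q) :
    Differentiable ℝ (bridgePenalty q : Param d → ℝ) := by
  unfold bridgePenalty
  refine Differentiable.fun_sum fun j _ => ?_
  have h1 : Differentiable ℝ fun t : ℝ => |t| ^ q :=
    fun t => (hasDerivAt_abs_rpow t hq).differentiableAt
  exact h1.comp (g := fun t : ℝ => |t| ^ q) (by fun_prop : Differentiable ℝ fun θ : Param d => θ j.succ)

lemma continuous_penLogLik {q : ℝ} (hq : 1 < q) (lam : ℝ) {m₁ m₂ : ℕ} (h₁ : 0 < m₁) (h₂ : 0 < m₂)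
    (x₁ x₂ : ℕ → 𝒳) : Continuous (penLogLik h q lam m₁ m₂ x₁ x₂) := by
  unfold penLogLik
  simp only [empLogLik_eq_sampleSum h h₁ h₂, sampleSum]
  have := continuous_bridgePenalty (d := d) hq
  have := continuous_softplus
  have := fun x => continuous_linPred (h := h) x
  fun_prop

/-- One term of the empirical log-likelihood is strictly concave along directions that are not
orthogonal to the design vector. -/
lemma softplus_linPred_lt {γ a b : ℝ} {θ θ' : Param d} {x : 𝒳}
    (ha : 0 < a) (hb : 0 < b) (hab : a + b = 1) (hne : inner ℝ (θ - θ') (design h x) ≠ 0) :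
    softplus (linPred h (a • θ + b • θ') x + γ) <
      a * softplus (linPred h θ x + γ) + b * softplus (linPred h θ' x + γ) := by
  have h1 : linPred h (a • θ + b • θ') x + γ =
      a * (linPred h θ x + γ) + b * (linPred h θ' x + γ) := by
    rw [linPred_add_smul]; linear_combination (-γ) * hab
  rw [h1]
  refine strictConvexOn_softplus.2 (Set.mem_univ _) (Set.mem_univ _) ?_ ha hb hab
  rw [inner_sub_left, ← linPred_eq_inner, ← linPred_eq_inner] at hne
  intro h2
  exact hne (by linarith)

lemma softplus_linPred_le {γ a b : ℝ} {θ θ' : Param d} {x : 𝒳}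
    (ha : 0 ≤ a) (hb : 0 ≤ b) (hab : a + b = 1) :
    softplus (linPred h (a • θ + b • θ') x + γ) ≤
      a * softplus (linPred h θ x + γ) + b * softplus (linPred h θ' x + γ) := by
  have h1 : linPred h (a • θ + b • θ') x + γ =
      a * (linPred h θ x + γ) + b * (linPred h θ' x + γ) := by
    rw [linPred_add_smul]; linear_combination (-γ) * hab
  rw [h1]
  exact strictConvexOn_softplus.convexOn.2 (Set.mem_univ _) (Set.mem_univ _) ha hb hab

lemma concaveOn_penLogLik {q : ℝ} (hq : 1 < q) {lam : ℝ} (hlam : 0 ≤ lam) {m₁ m₂ : ℕ}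
    (h₁ : 0 < m₁) (h₂ : 0 < m₂) (x₁ x₂ : ℕ → 𝒳) :
    ConcaveOn ℝ Set.univ (penLogLik h q lam m₁ m₂ x₁ x₂) := by
  refine ⟨convex_univ, fun θ _ θ' _ a b ha hb hab => ?_⟩
  have hJ := mul_le_mul_of_nonneg_left
    ((convexOn_bridgePenalty hq).2 (Set.mem_univ θ) (Set.mem_univ θ') ha hb hab) hlam
  simp only [penLogLik, empLogLik_eq_sampleSum h h₁ h₂, sampleSum, smul_eq_mul] at hJ ⊢
  have e₁ : ∀ j, a * (linPred h θ (x₁ j) - softplus (linPred h θ (x₁ j) + Real.log (m₁ / m₂)))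
      + b * (linPred h θ' (x₁ j) - softplus (linPred h θ' (x₁ j) + Real.log (m₁ / m₂))) ≤
      linPred h (a • θ + b • θ') (x₁ j)
        - softplus (linPred h (a • θ + b • θ') (x₁ j) + Real.log (m₁ / m₂)) := fun j => by
    have := softplus_linPred_le (h := h) (γ := Real.log (m₁ / m₂)) (θ := θ) (θ' := θ')
      (x := x₁ j) ha hb hab
    rw [linPred_add_smul] at *; linarith
  have e₂ : ∀ j, a * -softplus (linPred h θ (x₂ j) + Real.log (m₁ / m₂))
      + b * -softplus (linPred h θ' (x₂ j) + Real.log (m₁ / m₂)) ≤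
      -softplus (linPred h (a • θ + b • θ') (x₂ j) + Real.log (m₁ / m₂)) := fun j => by
    have := softplus_linPred_le (h := h) (γ := Real.log (m₁ / m₂)) (θ := θ) (θ' := θ')
      (x := x₂ j) ha hb hab
    linarith
  have s₁ := Finset.sum_le_sum (s := Finset.range m₁) fun j _ => e₁ j
  have s₂ := Finset.sum_le_sum (s := Finset.range m₂) fun j _ => e₂ j
  rw [Finset.sum_add_distrib, ← Finset.mul_sum, ← Finset.mul_sum] at s₁ s₂
  linarith

/-- If the design vectors of the two samples span the parameter space, then the penalized
log-likelihood has at most one maximizer. -/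
lemma IsPenMaximizer.eq {q : ℝ} (hq : 1 < q) {lam : ℝ} (hlam : 0 ≤ lam) {m₁ m₂ : ℕ}
    (h₁ : 0 < m₁) (h₂ : 0 < m₂) {x₁ x₂ : ℕ → 𝒳}
    (hspan : ∀ w : Param d, (∀ j < m₁, inner ℝ w (design h (x₁ j)) = 0) →
      (∀ j < m₂, inner ℝ w (design h (x₂ j)) = 0) → w = 0) {θ θ' : Param d}
    (hθ : IsPenMaximizer h q lam m₁ m₂ x₁ x₂ θ) (hθ' : IsPenMaximizer h q lam m₁ m₂ x₁ x₂ θ') :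
    θ = θ' := by
  by_contra hne
  have hw : θ - θ' ≠ 0 := sub_ne_zero.2 hne
  have hhalf : (2⁻¹ : ℝ) + 2⁻¹ = 1 := by norm_num
  have hpos : (0 : ℝ) < 2⁻¹ := by norm_num
  have heq := le_antisymm (hθ' θ) (hθ θ')
  have hmid := hθ ((2⁻¹ : ℝ) • θ + (2⁻¹ : ℝ) • θ')
  have hJ := mul_le_mul_of_nonneg_left
    ((convexOn_bridgePenalty hq).2 (Set.mem_univ θ) (Set.mem_univ θ') hpos.le hpos.le hhalf) hlam
  simp only [penLogLik, empLogLik_eq_sampleSum h h₁ h₂, sampleSum, smul_eq_mul] at hJ hmid heq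
  have e₁ : ∀ j, 2⁻¹ * (linPred h θ (x₁ j) - softplus (linPred h θ (x₁ j) + Real.log (m₁ / m₂)))
      + 2⁻¹ * (linPred h θ' (x₁ j) - softplus (linPred h θ' (x₁ j) + Real.log (m₁ / m₂))) ≤
      linPred h ((2⁻¹ : ℝ) • θ + (2⁻¹ : ℝ) • θ') (x₁ j)
        - softplus (linPred h ((2⁻¹ : ℝ) • θ + (2⁻¹ : ℝ) • θ') (x₁ j) + Real.log (m₁ / m₂)) :=
    fun j => by
    have := softplus_linPred_le (h := h) (γ := Real.log (m₁ / m₂)) (θ := θ) (θ' := θ')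
      (x := x₁ j) hpos.le hpos.le hhalf
    rw [linPred_add_smul] at *; linarith
  have e₂ : ∀ j, 2⁻¹ * -softplus (linPred h θ (x₂ j) + Real.log (m₁ / m₂))
      + 2⁻¹ * -softplus (linPred h θ' (x₂ j) + Real.log (m₁ / m₂)) ≤
      -softplus (linPred h ((2⁻¹ : ℝ) • θ + (2⁻¹ : ℝ) • θ') (x₂ j) + Real.log (m₁ / m₂)) :=
    fun j => by
    have := softplus_linPred_le (h := h) (γ := Real.log (m₁ / m₂)) (θ := θ) (θ' := θ')
      (x := x₂ j) hpos.le hpos.le hhalf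
    linarith
  have s₁ := Finset.sum_le_sum (s := Finset.range m₁) fun j _ => e₁ j
  have s₂ := Finset.sum_le_sum (s := Finset.range m₂) fun j _ => e₂ j
  have hex : (∃ j < m₁, inner ℝ (θ - θ') (design h (x₁ j)) ≠ 0) ∨
      ∃ j < m₂, inner ℝ (θ - θ') (design h (x₂ j)) ≠ 0 := by
    by_contra! hcon
    exact hw (hspan _ hcon.1 hcon.2)
  rcases hex with ⟨j, hj, hne'⟩ | ⟨j, hj, hne'⟩
  · have s₁' := Finset.sum_lt_sum (s := Finset.range m₁) (fun j _ => e₁ j)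
      ⟨j, Finset.mem_range.2 hj, by
        have := softplus_linPred_lt (h := h) (γ := Real.log (m₁ / m₂)) hpos hpos hhalf hne'
        rw [linPred_add_smul] at *; linarith⟩
    rw [Finset.sum_add_distrib, ← Finset.mul_sum, ← Finset.mul_sum] at s₁' s₂
    linarith
  · have s₂' := Finset.sum_lt_sum (s := Finset.range m₂) (fun j _ => e₂ j)
      ⟨j, Finset.mem_range.2 hj, by
        have := softplus_linPred_lt (h := h) (γ := Real.log (m₁ / m₂)) hpos hpos hhalf hne'
        linarith⟩
    rw [Finset.sum_add_distrib, ← Finset.mul_sum, ← Finset.mul_sum] at s₁ s₂'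
    linarith

end Concavity

/-- First order expansion of a differentiable penalty on the scale `s k → 0`, uniformly on
bounded sets, when the multiplier satisfies `lam k * s k → lam₀`. -/
lemma eventually_abs_penalty_expansion_le {E : Type*} [NormedAddCommGroup E]
    [InnerProductSpace ℝ E] [CompleteSpace E] {J : E → ℝ} {θ₀ : E} (hJ : DifferentiableAt ℝ J θ₀)
    {lam s : ℕ → ℝ} {lam₀ : ℝ} (hs : Tendsto s atTop (𝓝 0)) (hs0 : ∀ k, 0 ≤ s k)
    (hlam0 : ∀ k, 0 ≤ lam k)
    (hlam : Tendsto (fun k => lam k * s k) atTop (𝓝 lam₀)) (R : ℝ) {η : ℝ} (hη : 0 < η) :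
    ∀ᶠ k in atTop, ∀ u : E, ‖u‖ ≤ R →
      |lam k * (J (θ₀ + s k • u) - J θ₀) - lam₀ * inner ℝ u (gradient J θ₀)| ≤ η := by
  rcases lt_or_ge R 0 with hR | hR
  · exact Eventually.of_forall fun k u hu => absurd (norm_nonneg u) (not_le.2 (hu.trans_lt hR))
  have hlam₀ : 0 ≤ lam₀ := ge_of_tendsto' hlam fun k => mul_nonneg (hlam0 k) (hs0 k)
  have hg := hJ.hasGradientAt
  set b := gradient J θ₀
  set e := η / (2 * (lam₀ + 1) * (R + 1)) with he
  have he0 : 0 < e := by positivity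
  have h1 := (hasGradientAt_iff_isLittleO_nhds_zero.1 hg).def he0
  obtain ⟨t, ht, hball⟩ := Metric.eventually_nhds_iff_ball.1 h1
  have hsR : Tendsto (fun k => s k * R) atTop (𝓝 0) := by simpa using hs.mul_const R
  have hdiff : Tendsto (fun k => |lam k * s k - lam₀| * (R * ‖b‖)) atTop (𝓝 0) := by
    have := (hlam.sub_const lam₀).abs.mul_const (R * ‖b‖)
    simpa using this
  filter_upwards [hsR.eventually_lt_const ht, hlam.eventually_lt_const (lt_add_one lam₀),
    hdiff.eventually_lt_const (half_pos hη)] with k hk1 hk2 hk3 u hu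
  have hsu : ‖s k • u‖ ≤ s k * R := by
    rw [norm_smul, Real.norm_of_nonneg (hs0 k)]
    exact mul_le_mul_of_nonneg_left hu (hs0 k)
  have h2 := hball (s k • u) (mem_ball_zero_iff.2 (hsu.trans_lt hk1))
  rw [Real.norm_eq_abs, real_inner_smul_right, real_inner_comm] at h2
  have h3 : |lam k * s k - lam₀| * |inner ℝ u b| ≤ η / 2 := by
    refine le_trans ?_ hk3.le
    gcongr
    exact (abs_real_inner_le_norm u b).trans (by gcongr)
  have h4 : lam k * |J (θ₀ + s k • u) - J θ₀ - s k * inner ℝ u b| ≤ η / 2 := by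
    calc _ ≤ lam k * (e * (s k * R)) := by
          have := hlam0 k
          gcongr
          exact h2.trans (by gcongr)
      _ = (lam k * s k) * (e * R) := by ring
      _ ≤ (lam₀ + 1) * (e * (R + 1)) := by
          have := mul_nonneg (hlam0 k) (hs0 k)
          gcongr
          linarith
      _ = η / 2 := by rw [he]; field_simp
  have h5 : lam k * (J (θ₀ + s k • u) - J θ₀) - lam₀ * inner ℝ u b =
      lam k * (J (θ₀ + s k • u) - J θ₀ - s k * inner ℝ u b)
        + (lam k * s k - lam₀) * inner ℝ u b := by ring
  rw [h5]
  refine (abs_add_le _ _).trans ?_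
  rw [abs_mul, abs_mul, abs_of_nonneg (hlam0 k)]
  linarith

section InMeasure

variable {Ω : Type*} [MeasurableSpace Ω] {P : Measure Ω}

/-- Convergence to zero in measure of a sequence dominated by a finite sum of sequences that
converge to zero in measure. -/
lemma tendstoInMeasure_zero_of_norm_le_sum {ι E : Type*} [Fintype ι] [SeminormedAddCommGroup E]
    {F : ι → ℕ → Ω → ℝ} {W : ℕ → Ω → E}
    (hF : ∀ i, TendstoInMeasure P (F i) atTop 0)
    (hW : ∀ᶠ k in atTop, ∀ ω, ‖W k ω‖ ≤ ∑ i, ‖F i k ω‖) : TendstoInMeasure P W atTop 0 := by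
  rw [tendstoInMeasure_iff_norm]
  intro ε hε
  set e := ε / (Fintype.card ι + 1) with he
  have he0 : 0 < e := by positivity
  have hlim : Tendsto (fun k => ∑ i, P {ω | e ≤ ‖F i k ω - (0 : Ω → ℝ) ω‖}) atTop (𝓝 0) := by
    have := tendsto_finsetSum (Finset.univ : Finset ι) fun i _ =>
      tendstoInMeasure_iff_norm.1 (hF i) e he0
    simpa using this
  refine tendsto_of_tendsto_of_tendsto_of_le_of_le' tendsto_const_nhds hlim
    (Eventually.of_forall fun _ => zero_le) ?_
  filter_upwards [hW] with k hk
  refine (measure_mono fun ω hω => ?_).trans (measure_biUnion_finset_le Finset.univ _)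
  simp only [Set.mem_ofPred_eq, Set.mem_iUnion, Finset.mem_univ, exists_prop, true_and,
    Pi.zero_apply, sub_zero] at hω ⊢
  by_contra! hcon
  have h1 : ∑ i, ‖F i k ω‖ ≤ ∑ _i : ι, e := Finset.sum_le_sum fun i _ => (hcon i).le
  rw [Finset.sum_const, Finset.card_univ, nsmul_eq_mul] at h1
  have h2 : (Fintype.card ι : ℝ) * e < ε := by
    rw [he, mul_div_assoc', div_lt_iff₀ (by positivity)]; nlinarith
  linarith [hk ω]

lemma tendstoInMeasure_zero_add {A B : ℕ → Ω → ℝ} (hA : TendstoInMeasure P A atTop 0)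
    (hB : TendstoInMeasure P B atTop 0) :
    TendstoInMeasure P (fun k ω => A k ω + B k ω) atTop 0 := by
  refine tendstoInMeasure_zero_of_norm_le_sum (F := fun b : Bool => if b then A else B) ?_
    (Eventually.of_forall fun k ω => ?_)
  · rintro (_ | _)
    exacts [hB, hA]
  · simpa using norm_add_le (A k ω) (B k ω)

end InMeasure

section Law

variable {Ω : Type*} [MeasurableSpace Ω] {P : Measure Ω}
  {𝒳 : Type*} [MeasurableSpace 𝒳] {G : Measure 𝒳}

lemma _root_.ProbabilityTheory.HasLaw.integrable_comp {f : 𝒳 → ℝ} {Y : Ω → 𝒳}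
    (hY : HasLaw Y G P) (hf : Integrable f G) : Integrable (fun ω => f (Y ω)) P := by
  rw [← hY.map_eq] at hf
  exact hf.comp_aemeasurable hY.aemeasurable

lemma _root_.ProbabilityTheory.HasLaw.memLp_comp {f : 𝒳 → ℝ} {Y : Ω → 𝒳} {p : ENNReal}
    (hY : HasLaw Y G P) (hf : MemLp f p G) : MemLp (fun ω => f (Y ω)) p P := by
  rw [← hY.map_eq] at hf
  exact (memLp_map_measure_iff hf.aestronglyMeasurable hY.aemeasurable).1 hf

end Law

section OneSample

variable {Ω : Type*} [MeasurableSpace Ω] {P : Measure Ω} [IsProbabilityMeasure P]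
  {𝒳 : Type*} [MeasurableSpace 𝒳] {G : Measure 𝒳} {X : ℕ → Ω → 𝒳}

variable (hX : ∀ j, HasLaw (X j) G P) (hind : iIndepFun X P) {m : ℕ → ℕ} {N : ℕ → ℝ}

include hX in
/-- Averages of nonnegative functions with vanishing mean vanish in probability. -/
lemma tendstoInMeasure_avg {f : ℕ → 𝒳 → ℝ} (hf : ∀ k, Integrable (f k) G) (hf0 : ∀ k x, 0 ≤ f k x)
    (hlim : Tendsto (fun k => ∫ x, f k x ∂G) atTop (𝓝 0)) (hm : ∀ k, (m k : ℝ) ≤ N k) :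
    TendstoInMeasure P (fun k ω => (N k)⁻¹ * ∑ j ∈ Finset.range (m k), f k (X j ω)) atTop 0 := by
  rw [tendstoInMeasure_iff_measureReal_norm]
  intro ε hε
  have hN : ∀ k, 0 ≤ N k := fun k => (Nat.cast_nonneg _).trans (hm k)
  have hlim' : Tendsto (fun k => (∫ x, f k x ∂G) / ε) atTop (𝓝 0) := by
    simpa using hlim.div_const ε
  refine squeeze_zero (fun k => measureReal_nonneg) (fun k => ?_) hlim'
  have hI : ∀ j, Integrable (fun ω => f k (X j ω)) P := fun j => (hX j).integrable_comp (hf k)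
  have hnn : ∀ ω, 0 ≤ (N k)⁻¹ * ∑ j ∈ Finset.range (m k), f k (X j ω) := fun ω =>
    mul_nonneg (inv_nonneg.2 (hN k)) (Finset.sum_nonneg fun j _ => hf0 k _)
  have h1 := mul_meas_ge_le_integral_of_nonneg (μ := P)
    (f := fun ω => (N k)⁻¹ * ∑ j ∈ Finset.range (m k), f k (X j ω)) (ae_of_all _ hnn)
    ((integrable_finsetSum _ fun j _ => hI j).const_mul _) ε
  have h2 : ∀ j, ∫ ω, f k (X j ω) ∂P = ∫ x, f k x ∂G := fun j =>
    (hX j).integral_comp (hf k).aestronglyMeasurable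
  rw [integral_const_mul, integral_finsetSum _ fun j _ => hI j] at h1
  simp only [h2, Finset.sum_const, Finset.card_range, nsmul_eq_mul] at h1
  rw [le_div_iff₀ hε, mul_comm]
  have h3 : {ω | ε ≤ ‖(N k)⁻¹ * ∑ j ∈ Finset.range (m k), f k (X j ω) - (0 : Ω → ℝ) ω‖} =
      {ω | ε ≤ (N k)⁻¹ * ∑ j ∈ Finset.range (m k), f k (X j ω)} := by
    ext ω
    simp only [Pi.zero_apply, sub_zero, Set.mem_ofPred_eq, Real.norm_of_nonneg (hnn ω)]
  rw [h3]
  refine h1.trans ?_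
  have h4 : 0 ≤ ∫ x, f k x ∂G := integral_nonneg (hf0 k)
  rw [← mul_assoc]
  refine mul_le_of_le_one_left h4 ?_
  rw [inv_mul_eq_div]
  exact div_le_one_of_le₀ (hm k) (hN k)

omit [IsProbabilityMeasure P] in
include hX hind in
/-- Strong law of large numbers along a sequence of sample sizes. -/
lemma ae_tendsto_avg {f : 𝒳 → ℝ} (hfm : Measurable f) (hf : Integrable f G)
    (hm : Tendsto m atTop atTop) {p : ℝ} (hp : Tendsto (fun k => (m k : ℝ) / N k) atTop (𝓝 p)) :
    ∀ᵐ ω ∂P, Tendsto (fun k => (N k)⁻¹ * ∑ j ∈ Finset.range (m k), f (X j ω)) atTop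
      (𝓝 (p * ∫ x, f x ∂G)) := by
  have h1 := strong_law_ae_real (fun j ω => f (X j ω)) ((hX 0).integrable_comp hf)
    (fun i j hij => (hind.comp (fun _ => f) fun _ => hfm).indepFun hij)
    (fun i => ((hX i).identDistrib (hX 0)).comp hfm)
  have h2 : ∫ ω, f (X 0 ω) ∂P = ∫ x, f x ∂G := (hX 0).integral_comp hf.aestronglyMeasurable
  rw [h2] at h1
  filter_upwards [h1] with ω hω
  refine (hp.mul (hω.comp hm)).congr' ?_
  filter_upwards [hm.eventually_gt_atTop 0] with k hk
  have : (m k : ℝ) ≠ 0 := by positivity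
  simp only [Function.comp]
  field_simp

include hX hind in
/-- Normalized centered sums of functions with vanishing second moment vanish in probability. -/
lemma tendstoInMeasure_centered_sum {g : ℕ → 𝒳 → ℝ} (hgm : ∀ k, Measurable (g k))
    (hg : ∀ k, MemLp (g k) 2 G) (hlim : Tendsto (fun k => ∫ x, g k x ^ 2 ∂G) atTop (𝓝 0))
    (hm : ∀ k, (m k : ℝ) ≤ N k) :
    TendstoInMeasure P (fun k ω => (√(N k))⁻¹ *
      ∑ j ∈ Finset.range (m k), (g k (X j ω) - ∫ x, g k x ∂G)) atTop 0 := by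
  rw [tendstoInMeasure_iff_norm]
  intro ε hε
  have hN : ∀ k, 0 ≤ N k := fun k => (Nat.cast_nonneg _).trans (hm k)
  have hlim' : Tendsto (fun k => ENNReal.ofReal ((∫ x, g k x ^ 2 ∂G) / ε ^ 2)) atTop (𝓝 0) := by
    have := ENNReal.tendsto_ofReal (hlim.div_const (ε ^ 2))
    simpa using this
  refine tendsto_of_tendsto_of_tendsto_of_le_of_le tendsto_const_nhds hlim'
    (fun _ => zero_le) fun k => ?_
  set Y : ℕ → Ω → ℝ := fun j ω => g k (X j ω) with hY
  have hY2 : ∀ j, MemLp (Y j) 2 P := fun j => (hX j).memLp_comp (hg k)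
  have hYi : ∀ j, ∫ ω, Y j ω ∂P = ∫ x, g k x ∂G := fun j =>
    (hX j).integral_comp (hg k).aestronglyMeasurable
  have hYv : ∀ j, Var[Y j; P] ≤ ∫ x, g k x ^ 2 ∂G := fun j => by
    refine (variance_le_expectation_sq (hY2 j).aestronglyMeasurable).trans (le_of_eq ?_)
    exact (hX j).integral_comp (f := fun x => g k x ^ 2) ((hgm k).pow_const 2).aestronglyMeasurable
  set W : Ω → ℝ := (√(N k))⁻¹ • ∑ j ∈ Finset.range (m k), Y j with hW
  have hW2 : MemLp W 2 P := (memLp_finsetSum' _ fun j _ => hY2 j).const_smul _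
  have hWv : Var[W; P] ≤ ∫ x, g k x ^ 2 ∂G := by
    rw [hW, variance_smul, IndepFun.variance_sum (fun j _ => hY2 j) (fun i _ j _ hij =>
      (hind.comp (fun _ => g k) fun _ => hgm k).indepFun hij), inv_pow, Real.sq_sqrt (hN k)]
    have h0 : 0 ≤ ∫ x, g k x ^ 2 ∂G := integral_nonneg fun x => sq_nonneg _
    calc (N k)⁻¹ * ∑ j ∈ Finset.range (m k), Var[Y j; P]
        ≤ (N k)⁻¹ * ∑ j ∈ Finset.range (m k), ∫ x, g k x ^ 2 ∂G := by
          have := hN k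
          gcongr with j; exact hYv j
      _ = (m k / N k) * ∫ x, g k x ^ 2 ∂G := by
          rw [Finset.sum_const, Finset.card_range, nsmul_eq_mul]; ring
      _ ≤ _ := mul_le_of_le_one_left h0 (div_le_one_of_le₀ (hm k) (hN k))
  have hWi : ∫ ω, W ω ∂P = (√(N k))⁻¹ * ∑ j ∈ Finset.range (m k), ∫ x, g k x ∂G := by
    have : ∀ ω, W ω = (√(N k))⁻¹ * ∑ j ∈ Finset.range (m k), Y j ω := fun ω => by simp [hW]
    simp only [this]
    rw [integral_const_mul, integral_finsetSum _ fun j _ => (hY2 j).integrable (by norm_num)]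
    simp only [hYi]
  have h1 := meas_ge_le_variance_div_sq hW2 hε
  have h2 : {ω | ε ≤ ‖(√(N k))⁻¹ * ∑ j ∈ Finset.range (m k), (g k (X j ω) - ∫ x, g k x ∂G)
      - (0 : Ω → ℝ) ω‖} = {ω | ε ≤ |W ω - ∫ ω, W ω ∂P|} := by
    ext ω
    simp only [Pi.zero_apply, sub_zero, Set.mem_ofPred_eq, Real.norm_eq_abs, hWi]
    rw [Finset.sum_sub_distrib, mul_sub]
    simp [hW, hY]
  rw [h2]
  refine h1.trans (ENNReal.ofReal_le_ofReal ?_)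
  gcongr

include hX hind in
/-- Central limit theorem along a sequence of sample sizes, for the characteristic function. -/
lemma tendsto_charFun_centered_sum {g : 𝒳 → ℝ} (hgm : Measurable g) (hg : MemLp g 2 G)
    (hm : Tendsto m atTop atTop) {p : ℝ} (hN : ∀ k, 0 ≤ N k)
    (hp : Tendsto (fun k => (m k : ℝ) / N k) atTop (𝓝 p)) (t : ℝ) :
    Tendsto (fun k => charFun (P.map fun ω => (√(N k))⁻¹ *
      ∑ j ∈ Finset.range (m k), (g (X j ω) - ∫ x, g x ∂G)) t) atTop
      (𝓝 (Complex.exp (-(p * Var[g; G] * t ^ 2 / 2 : ℝ)))) := by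
  set Y : ℕ → Ω → ℝ := fun j ω => g (X j ω) with hY
  have hp0 : 0 ≤ p := ge_of_tendsto' hp fun k => div_nonneg (Nat.cast_nonneg _) (hN k)
  have hY2 : ∀ j, MemLp (Y j) 2 P := fun j => (hX j).memLp_comp hg
  have hYi : ∫ ω, Y 0 ω ∂P = ∫ x, g x ∂G := (hX 0).integral_comp hg.aestronglyMeasurable
  have hYv : Var[Y 0; P] = Var[g; G] := by
    have h1 := variance_map (μ := P) (X := g) (Y := X 0)
      (by rw [(hX 0).map_eq]; exact hgm.aemeasurable) (hX 0).aemeasurable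
    rw [(hX 0).map_eq] at h1
    exact h1.symm
  have clt := tendstoInDistribution_inv_sqrt_mul_sum_sub (P := P) (X := Y)
    (P' := gaussianReal 0 Var[Y 0; P].toNNReal) (Y := id) HasLaw.id (hY2 0)
    (hind.comp (fun _ => g) fun _ => hgm) (fun i => ((hX i).identDistrib (hX 0)).comp hgm)
  have clt' : TendstoInDistribution (fun k ω => (√(m k : ℝ))⁻¹ *
      (∑ j ∈ Finset.range (m k), Y j ω - m k * P[Y 0])) atTop id (fun _ => P)
      (gaussianReal 0 Var[Y 0; P].toNNReal) :=
    ⟨fun k => clt.forall_aemeasurable (m k), clt.aemeasurable_limit, clt.tendsto.comp hm⟩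
  have hc : Tendsto (fun k => √(m k / N k : ℝ)) atTop (𝓝 √p) :=
    (Real.continuous_sqrt.tendsto p).comp hp
  have hc' : TendstoInMeasure P (fun k (_ : Ω) => √(m k / N k : ℝ)) atTop (fun _ => √p) :=
    tendstoInMeasure_of_tendsto_ae (fun _ => aestronglyMeasurable_const) (ae_of_all _ fun _ => hc)
  have hsl := TendstoInDistribution.continuous_comp_prodMk_of_tendstoInMeasure_const
    (g := fun z : ℝ × ℝ => z.2 * z.1) (by fun_prop) clt' hc' (fun _ => aemeasurable_const)
  have hlim := ProbabilityMeasure.tendsto_iff_tendsto_charFun.1 hsl.tendsto t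
  have hlaw : HasLaw (fun ω => √p * id ω)
      (gaussianReal (√p * 0) (NNReal.mk (√p ^ 2) (sq_nonneg _) * Var[Y 0; P].toNNReal))
      (gaussianReal 0 Var[Y 0; P].toNNReal) := gaussianReal_const_mul HasLaw.id _
  simp only [ProbabilityMeasure.coe_mk] at hlim
  rw [hlaw.map_eq, charFun_gaussianReal] at hlim
  have hval : Complex.exp (t * ((√p * 0 : ℝ) : ℂ) * Complex.I
      - ((NNReal.mk (√p ^ 2) (sq_nonneg _) * Var[Y 0; P].toNNReal : NNReal) : ℝ) * t ^ 2 / 2) =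
      Complex.exp (-(p * Var[g; G] * t ^ 2 / 2 : ℝ)) := by
    congr 1
    rw [NNReal.coe_mul, NNReal.coe_mk, Real.coe_toNNReal _ (variance_nonneg _ _), hYv,
      Real.sq_sqrt hp0]
    push_cast
    ring
  rw [hval] at hlim
  refine hlim.congr' ?_
  filter_upwards [hm.eventually_gt_atTop 0] with k hk
  congr 2
  funext ω
  have hmk : (0 : ℝ) < m k := by positivity
  have hs : 0 < √(m k : ℝ) := Real.sqrt_pos.2 hmk
  rw [Real.sqrt_div hmk.le, Finset.sum_sub_distrib, Finset.sum_const, Finset.card_range,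
    nsmul_eq_mul, hYi, ← mul_assoc]
  congr 1
  field_simp

end OneSample

section TwoSample

variable {Ω : Type*} [MeasurableSpace Ω] {P : Measure Ω} [IsProbabilityMeasure P]
  {𝒳 : Type*} [MeasurableSpace 𝒳] {G₁ G₂ : Measure 𝒳} [IsProbabilityMeasure G₁]
  [IsProbabilityMeasure G₂] {X₁ X₂ : ℕ → Ω → 𝒳}

omit [IsProbabilityMeasure P] in
lemma iIndepFun_left (hindep : iIndepFun (fun s : ℕ ⊕ ℕ => Sum.elim X₁ X₂ s) P) :
    iIndepFun X₁ P :=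
  hindep.precomp (g := Sum.inl) Sum.inl_injective

omit [IsProbabilityMeasure P] in
lemma iIndepFun_right (hindep : iIndepFun (fun s : ℕ ⊕ ℕ => Sum.elim X₁ X₂ s) P) :
    iIndepFun X₂ P :=
  hindep.precomp (g := Sum.inr) Sum.inr_injective

omit [IsProbabilityMeasure P] in
/-- Sums over two independent samples are independent. -/
lemma indepFun_sum_sum (hX₁ : ∀ j, AEMeasurable (X₁ j) P) (hX₂ : ∀ j, AEMeasurable (X₂ j) P)
    (hindep : iIndepFun (fun s : ℕ ⊕ ℕ => Sum.elim X₁ X₂ s) P)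
    {g₁ g₂ : 𝒳 → ℝ} (hg₁ : Measurable g₁) (hg₂ : Measurable g₂) (m₁ m₂ : ℕ) (c : ℝ) :
    IndepFun (fun ω => c * ∑ j ∈ Finset.range m₁, g₁ (X₁ j ω))
      (fun ω => c * ∑ j ∈ Finset.range m₂, g₂ (X₂ j ω)) P := by
  set Y : ℕ ⊕ ℕ → Ω → ℝ := fun s => Sum.elim (fun _ => g₁) (fun _ => g₂) s ∘ Sum.elim X₁ X₂ s
    with hY
  have hYind : iIndepFun Y P := hindep.comp (fun s => Sum.elim (fun _ => g₁) (fun _ => g₂) s)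
    (by rintro (j | j); exacts [hg₁, hg₂])
  have hYm : ∀ s, AEMeasurable (Y s) P := by
    rintro (j | j)
    exacts [hg₁.comp_aemeasurable (hX₁ j), hg₂.comp_aemeasurable (hX₂ j)]
  set S : Finset (ℕ ⊕ ℕ) := (Finset.range m₁).map Function.Embedding.inl
  set T : Finset (ℕ ⊕ ℕ) := (Finset.range m₂).map Function.Embedding.inr
  have hST : Disjoint S T := by
    rw [Finset.disjoint_left]
    rintro (j | j) h1 h2 <;> simp [S, T] at h1 h2
  have h1 := (hYind.indepFun_finset₀ S T hST hYm).comp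
    (φ := fun v : S → ℝ => c * ∑ i, v i) (ψ := fun v : T → ℝ => c * ∑ i, v i)
    (by fun_prop) (by fun_prop)
  have e1 : (fun ω => c * ∑ j ∈ Finset.range m₁, g₁ (X₁ j ω)) =
      (fun v : S → ℝ => c * ∑ i, v i) ∘ fun a i => Y i a := by
    funext ω
    simp only [Function.comp]
    rw [Finset.sum_coe_sort S (fun s => Y s ω), Finset.sum_map]
    rfl
  have e2 : (fun ω => c * ∑ j ∈ Finset.range m₂, g₂ (X₂ j ω)) =
      (fun v : T → ℝ => c * ∑ i, v i) ∘ fun a i => Y i a := by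
    funext ω
    simp only [Function.comp]
    rw [Finset.sum_coe_sort T (fun s => Y s ω), Finset.sum_map]
    rfl
  rw [e1, e2]
  exact h1

variable {ι : Type*} [Fintype ι]

/-- Two-sample multivariate central limit theorem, for the characteristic function. -/
lemma tendsto_charFun_two_sample (hX₁ : ∀ j, HasLaw (X₁ j) G₁ P) (hX₂ : ∀ j, HasLaw (X₂ j) G₂ P)
    (hindep : iIndepFun (fun s : ℕ ⊕ ℕ => Sum.elim X₁ X₂ s) P)
    {η₁ η₂ : 𝒳 → EuclideanSpace ℝ ι} (hη₁m : Measurable η₁) (hη₂m : Measurable η₂)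
    (hη₁ : MemLp η₁ 2 G₁) (hη₂ : MemLp η₂ 2 G₂) {m₁ m₂ : ℕ → ℕ} {N : ℕ → ℝ} (hN : ∀ k, 0 ≤ N k)
    (hm₁ : Tendsto m₁ atTop atTop) (hm₂ : Tendsto m₂ atTop atTop) {p₁ p₂ : ℝ}
    (hp₁ : Tendsto (fun k => (m₁ k : ℝ) / N k) atTop (𝓝 p₁))
    (hp₂ : Tendsto (fun k => (m₂ k : ℝ) / N k) atTop (𝓝 p₂)) (t : EuclideanSpace ℝ ι) :
    Tendsto (fun k => charFun (P.map fun ω => (√(N k))⁻¹ •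
      (∑ j ∈ Finset.range (m₁ k), (η₁ (X₁ j ω) - ∫ x, η₁ x ∂G₁)
        + ∑ j ∈ Finset.range (m₂ k), (η₂ (X₂ j ω) - ∫ x, η₂ x ∂G₂))) t) atTop
      (𝓝 (Complex.exp (-((p₁ * Var[fun x => inner ℝ t (η₁ x); G₁]
        + p₂ * Var[fun x => inner ℝ t (η₂ x); G₂]) / 2 : ℝ)))) := by
  have hi₁ : ∫ x, inner ℝ t (η₁ x) ∂G₁ = inner ℝ t (∫ x, η₁ x ∂G₁) :=
    integral_inner (hη₁.integrable (by norm_num)) t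
  have hi₂ : ∫ x, inner ℝ t (η₂ x) ∂G₂ = inner ℝ t (∫ x, η₂ x ∂G₂) :=
    integral_inner (hη₂.integrable (by norm_num)) t
  have l₁ := tendsto_charFun_centered_sum hX₁ (iIndepFun_left hindep)
    (g := fun x => inner ℝ t (η₁ x)) (by fun_prop) (hη₁.const_inner t) hm₁ hN hp₁ 1
  have l₂ := tendsto_charFun_centered_sum hX₂ (iIndepFun_right hindep)
    (g := fun x => inner ℝ t (η₂ x)) (by fun_prop) (hη₂.const_inner t) hm₂ hN hp₂ 1
  have l := l₁.mul l₂
  rw [← Complex.exp_add, ← Complex.ofReal_neg, ← Complex.ofReal_neg, ← Complex.ofReal_add] at l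
  have hval : -(p₁ * Var[fun x => inner ℝ t (η₁ x); G₁] * 1 ^ 2 / 2)
      + -(p₂ * Var[fun x => inner ℝ t (η₂ x); G₂] * 1 ^ 2 / 2) =
      -((p₁ * Var[fun x => inner ℝ t (η₁ x); G₁]
        + p₂ * Var[fun x => inner ℝ t (η₂ x); G₂]) / 2) := by ring
  rw [hval, Complex.ofReal_neg] at l
  refine l.congr fun k => ?_
  have hind := indepFun_sum_sum (fun j => (hX₁ j).aemeasurable) (fun j => (hX₂ j).aemeasurable)
    hindep (g₁ := fun x => inner ℝ t (η₁ x) - ∫ x, inner ℝ t (η₁ x) ∂G₁)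
    (g₂ := fun x => inner ℝ t (η₂ x) - ∫ x, inner ℝ t (η₂ x) ∂G₂)
    (by fun_prop) (by fun_prop) (m₁ k) (m₂ k) (√(N k))⁻¹
  have hη₁c : ∀ j, AEMeasurable (fun ω => η₁ (X₁ j ω)) P := fun j =>
    hη₁m.comp_aemeasurable (hX₁ j).aemeasurable
  have hη₂c : ∀ j, AEMeasurable (fun ω => η₂ (X₂ j ω)) P := fun j =>
    hη₂m.comp_aemeasurable (hX₂ j).aemeasurable
  have hmul := congrFun (hind.charFun_map_fun_add_eq_mul (by fun_prop) (by fun_prop)) 1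
  rw [Pi.mul_apply] at hmul
  rw [← hmul, charFun_apply, charFun_apply, integral_map (by fun_prop) (by fun_prop),
    integral_map (by fun_prop) (by fun_prop)]
  congr 1
  funext ω
  congr 3
  simp only [hi₁, hi₂, ← inner_sub_right, ← inner_sum]
  rw [real_inner_comm t (_ • _), real_inner_smul_right, inner_add_right]
  simp [mul_add]

/-- Two-sample multivariate central limit theorem. -/
lemma tendstoInDistribution_two_sample [DecidableEq ι]
    (hX₁ : ∀ j, HasLaw (X₁ j) G₁ P) (hX₂ : ∀ j, HasLaw (X₂ j) G₂ P)
    (hindep : iIndepFun (fun s : ℕ ⊕ ℕ => Sum.elim X₁ X₂ s) P)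
    {η₁ η₂ : 𝒳 → EuclideanSpace ℝ ι} (hη₁m : Measurable η₁) (hη₂m : Measurable η₂)
    (hη₁ : MemLp η₁ 2 G₁) (hη₂ : MemLp η₂ 2 G₂) {m₁ m₂ : ℕ → ℕ} {N : ℕ → ℝ} (hN : ∀ k, 0 ≤ N k)
    (hm₁ : Tendsto m₁ atTop atTop) (hm₂ : Tendsto m₂ atTop atTop) {p₁ p₂ : ℝ}
    (hp₁ : Tendsto (fun k => (m₁ k : ℝ) / N k) atTop (𝓝 p₁))
    (hp₂ : Tendsto (fun k => (m₂ k : ℝ) / N k) atTop (𝓝 p₂)) {V : Matrix ι ι ℝ}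
    (hV : V.PosSemidef) (hquad : ∀ t : EuclideanSpace ℝ ι, t ⬝ᵥ Matrix.mulVec V t =
      p₁ * Var[fun x => inner ℝ t (η₁ x); G₁] + p₂ * Var[fun x => inner ℝ t (η₂ x); G₂]) :
    TendstoInDistribution (fun k ω => (√(N k))⁻¹ •
      (∑ j ∈ Finset.range (m₁ k), (η₁ (X₁ j ω) - ∫ x, η₁ x ∂G₁)
        + ∑ j ∈ Finset.range (m₂ k), (η₂ (X₂ j ω) - ∫ x, η₂ x ∂G₂))) atTop id (fun _ => P)
      (multivariateGaussian (0 : EuclideanSpace ℝ ι) V) where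
  forall_aemeasurable k := by
    have hη₁c : ∀ j, AEMeasurable (fun ω => η₁ (X₁ j ω)) P := fun j =>
      hη₁m.comp_aemeasurable (hX₁ j).aemeasurable
    have hη₂c : ∀ j, AEMeasurable (fun ω => η₂ (X₂ j ω)) P := fun j =>
      hη₂m.comp_aemeasurable (hX₂ j).aemeasurable
    fun_prop
  tendsto := by
    refine ProbabilityMeasure.tendsto_iff_tendsto_charFun.2 fun t => ?_
    simp only [ProbabilityMeasure.coe_mk, Measure.map_id]
    rw [charFun_multivariateGaussian hV, hquad]
    convert tendsto_charFun_two_sample hX₁ hX₂ hindep hη₁m hη₂m hη₁ hη₂ hN hm₁ hm₂ hp₁ hp₂ t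
      using 3
    simp

end TwoSample

/-- A positive definite quadratic form is bounded below by a multiple of the squared norm. -/
lemma exists_pos_mul_sq_le_of_posDef {n : ℕ} {M : Matrix (Fin (n + 1)) (Fin (n + 1)) ℝ}
    (hM : M.PosDef) : ∃ κ : ℝ, 0 < κ ∧
      ∀ t : Param n, κ * ‖t‖ ^ 2 ≤ inner ℝ t (Matrix.toEuclideanCLM (𝕜 := ℝ) M t) := by
  set T := Matrix.toEuclideanCLM (𝕜 := ℝ) M
  have hpos : ∀ t : Param n, t ≠ 0 → 0 < inner ℝ t (T t) := fun t ht => by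
    rw [Matrix.inner_toEuclideanCLM]
    simpa using hM.dotProduct_mulVec_pos (x := t.ofLp) (by simpa using ht)
  obtain ⟨u, hu, hmin⟩ := (isCompact_sphere (0 : Param n) 1).exists_isMinOn
    (NormedSpace.sphere_nonempty.2 zero_le_one) (f := fun t => inner ℝ t (T t)) (by fun_prop)
  have hu0 : u ≠ 0 := by
    rintro rfl
    simp at hu
  refine ⟨_, hpos u hu0, fun t => ?_⟩
  rcases eq_or_ne t 0 with rfl | ht
  · simp
  have hn : 0 < ‖t‖ := norm_pos_iff.2 ht
  have h1 := hmin (show ‖t‖⁻¹ • t ∈ Metric.sphere (0 : Param n) 1 by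
    rw [mem_sphere_zero_iff_norm, norm_smul, norm_inv, norm_norm, inv_mul_cancel₀ hn.ne'])
  simp only [Set.mem_ofPred_eq, map_smul, real_inner_smul_left, real_inner_smul_right] at h1
  calc _ ≤ ‖t‖⁻¹ * (‖t‖⁻¹ * inner ℝ t (T t)) * ‖t‖ ^ 2 := by gcongr
    _ = _ := by field_simp

section Moments

variable {𝒳 : Type*} [MeasurableSpace 𝒳] {d : ℕ} {h : 𝒳 → Fin d → ℝ} {θ₀ : Param d}
  {G₁ G₂ : Measure 𝒳} {ρ : ℝ}

lemma measurable_design (hh : Measurable h) : Measurable (design h) := by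
  refine (WithLp.measurable_toLp 2 _).comp (measurable_pi_lambda _ fun i => ?_)
  refine Fin.cases ?_ (fun j => ?_) i
  · simp
  · simpa [Function.comp_def] using (measurable_pi_apply j).comp hh

lemma measurable_linPred (hh : Measurable h) (θ : Param d) : Measurable (linPred h θ) := by
  have := measurable_design hh
  have h1 : linPred h θ = fun x => inner ℝ θ (design h x) := funext (linPred_eq_inner h θ)
  rw [h1]
  fun_prop

lemma measurable_sigmoid_linPred (hh : Measurable h) (θ : Param d) (γ : ℝ) :
    Measurable fun x => Real.sigmoid (linPred h θ x + γ) := by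
  have h1 : Continuous Real.sigmoid :=
    continuous_iff_continuousAt.2 fun t => (Real.hasDerivAt_sigmoid t).continuousAt
  exact h1.measurable.comp ((measurable_linPred hh θ).add_const γ)

lemma measurable_sigmoidDeriv_linPred (hh : Measurable h) (θ : Param d) (γ : ℝ) :
    Measurable fun x => sigmoidDeriv (linPred h θ x + γ) :=
  continuous_sigmoidDeriv.measurable.comp ((measurable_linPred hh θ).add_const γ)

lemma exp_mul_one_sub_sigmoid (hρ : 0 < ρ) (s : ℝ) :
    Real.exp s * (1 - Real.sigmoid (s + Real.log ρ)) = ρ⁻¹ * Real.sigmoid (s + Real.log ρ) := by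
  rw [one_sub_sigmoid_eq, sigmoid_eq_exp_div, ← exp_mul_add_log hρ]
  have := Real.exp_pos s
  field_simp

variable {E : Type*} [NormedAddCommGroup E] [NormedSpace ℝ E]

/-- Change of measure in the density ratio model. -/
lemma DensityRatioModel.integral_one_sub_sigmoid (hmodel : DensityRatioModel h θ₀ G₁ G₂)
    (hh : Measurable h) (hρ : 0 < ρ) (f : 𝒳 → E) :
    ∫ x, (1 - Real.sigmoid (linPred h θ₀ x + Real.log ρ)) • f x ∂G₁ =
      ρ⁻¹ • ∫ x, Real.sigmoid (linPred h θ₀ x + Real.log ρ) • f x ∂G₂ := by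
  have hm := measurable_linPred hh θ₀
  rw [hmodel, integral_withDensity_eq_integral_toReal_smul (by fun_prop)
    (ae_of_all _ fun x => ENNReal.ofReal_lt_top), ← integral_smul]
  congr 1
  funext x
  rw [ENNReal.toReal_ofReal (Real.exp_pos _).le, smul_smul, smul_smul,
    exp_mul_one_sub_sigmoid hρ]

/-- Change of measure in the density ratio model. -/
lemma DensityRatioModel.integrable_one_sub_sigmoid_iff (hmodel : DensityRatioModel h θ₀ G₁ G₂)
    (hh : Measurable h) (hρ : 0 < ρ) (f : 𝒳 → E) :
    Integrable (fun x => (1 - Real.sigmoid (linPred h θ₀ x + Real.log ρ)) • f x) G₁ ↔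
      Integrable (fun x => Real.sigmoid (linPred h θ₀ x + Real.log ρ) • f x) G₂ := by
  have hm := measurable_linPred hh θ₀
  rw [hmodel, integrable_withDensity_iff_integrable_smul' (by fun_prop)
    (ae_of_all _ fun x => ENNReal.ofReal_lt_top),
    ← integrable_smul_iff (c := ρ⁻¹) (f := fun x => Real.sigmoid _ • f x) (inv_ne_zero hρ.ne')]
  refine iff_of_eq ?_
  congr 1
  funext x
  rw [ENNReal.toReal_ofReal (Real.exp_pos _).le, smul_smul, Pi.smul_apply, smul_smul,
    exp_mul_one_sub_sigmoid hρ]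

lemma measurable_design_apply (hh : Measurable h) (i : Fin (d + 1)) :
    Measurable fun x => design h x i :=
  (EuclideanSpace.proj (𝕜 := ℝ) i).measurable.comp (measurable_design hh)

/-- The entries of `A`, in terms of the sigmoid function. -/
lemma mul_matA_apply (hρ : 0 < ρ) (i j : Fin (d + 1)) :
    ρ * matA h ρ θ₀ G₂ i j =
      ∫ x, Real.sigmoid (linPred h θ₀ x + Real.log ρ) * (design h x i * design h x j) ∂G₂ := by
  rw [matA, Matrix.of_apply, ← integral_const_mul]
  congr 1
  funext x
  rw [sigmoid_eq_exp_div, ← exp_mul_add_log hρ]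
  ring

/-- Boundedness by the squared norm of the design vector gives integrability against the
sigmoid weights. -/
structure SigmoidMoments (h : 𝒳 → Fin d → ℝ) (θ₀ : Param d) (ρ : ℝ) (G₁ G₂ : Measure 𝒳) :
    Prop where
  model : DensityRatioModel h θ₀ G₁ G₂
  meas : Measurable h
  pos : 0 < ρ
  int_deriv₁ : Integrable
    (fun x => sigmoidDeriv (linPred h θ₀ x + Real.log ρ) * ‖design h x‖ ^ 2) G₁
  int_deriv₂ : Integrable
    (fun x => sigmoidDeriv (linPred h θ₀ x + Real.log ρ) * ‖design h x‖ ^ 2) G₂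

namespace SigmoidMoments

variable (H : SigmoidMoments h θ₀ ρ G₁ G₂)
include H

lemma integrable_sigmoid : Integrable
    (fun x => Real.sigmoid (linPred h θ₀ x + Real.log ρ) * ‖design h x‖ ^ 2) G₂ := by
  have h1 := (H.model.integrable_one_sub_sigmoid_iff H.meas H.pos
    (fun x => Real.sigmoid (linPred h θ₀ x + Real.log ρ) * ‖design h x‖ ^ 2)).1 (by
      refine H.int_deriv₁.congr (ae_of_all _ fun x => ?_)
      simp only [sigmoidDeriv, smul_eq_mul]; ring)
  refine (H.int_deriv₂.add h1).congr (ae_of_all _ fun x => ?_)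
  simp only [sigmoidDeriv, smul_eq_mul, Pi.add_apply]; ring

/-- Integrability under `G₂` of functions dominated by the sigmoid weight times `‖z‖ ^ 2`. -/
lemma integrable_of_le {f : 𝒳 → ℝ} (hf : Measurable f)
    (hle : ∀ x, |f x| ≤ Real.sigmoid (linPred h θ₀ x + Real.log ρ) * ‖design h x‖ ^ 2) :
    Integrable f G₂ :=
  H.integrable_sigmoid.mono' hf.aestronglyMeasurable (ae_of_all _ hle)

lemma memLp_left :
    MemLp (fun x => (1 - Real.sigmoid (linPred h θ₀ x + Real.log ρ)) • design h x) 2 G₁ := by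
  have hz := measurable_design H.meas
  have hs := measurable_sigmoid_linPred H.meas θ₀ (Real.log ρ)
  rw [memLp_two_iff_integrable_sq_norm (by fun_prop)]
  have h1 := (H.model.integrable_one_sub_sigmoid_iff H.meas H.pos
    (fun x => (1 - Real.sigmoid (linPred h θ₀ x + Real.log ρ)) * ‖design h x‖ ^ 2)).2 (by
      refine H.int_deriv₂.congr (ae_of_all _ fun x => ?_)
      simp only [sigmoidDeriv, smul_eq_mul]; ring)
  refine h1.congr (ae_of_all _ fun x => ?_)
  simp only [norm_smul, smul_eq_mul, mul_pow, Real.norm_eq_abs, sq_abs]; ring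

lemma memLp_right :
    MemLp (fun x => Real.sigmoid (linPred h θ₀ x + Real.log ρ) • design h x) 2 G₂ := by
  have hz := measurable_design H.meas
  have hs := measurable_sigmoid_linPred H.meas θ₀ (Real.log ρ)
  rw [memLp_two_iff_integrable_sq_norm (by fun_prop)]
  refine H.integrable_of_le (by fun_prop) fun x => ?_
  have h0 := Real.sigmoid_nonneg (linPred h θ₀ x + Real.log ρ)
  have h1 := Real.sigmoid_le_one (linPred h θ₀ x + Real.log ρ)
  rw [abs_of_nonneg (by positivity), norm_smul, mul_pow, Real.norm_of_nonneg h0, sq]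
  gcongr
  exact mul_le_of_le_one_left h0 h1

lemma integrable_entry (i j : Fin (d + 1)) : Integrable (fun x =>
    Real.sigmoid (linPred h θ₀ x + Real.log ρ) * (design h x i * design h x j)) G₂ := by
  have hz := measurable_design H.meas
  have hs := measurable_sigmoid_linPred H.meas θ₀ (Real.log ρ)
  refine H.integrable_of_le (hs.mul ((measurable_design_apply H.meas i).mul
    (measurable_design_apply H.meas j))) fun x => ?_
  have h0 := Real.sigmoid_nonneg (linPred h θ₀ x + Real.log ρ)
  rw [abs_mul, abs_of_nonneg h0, abs_mul, sq]
  gcongr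
  exacts [PiLp.norm_apply_le (design h x) i, PiLp.norm_apply_le (design h x) j]

/-- The quadratic form of `A`. -/
lemma mul_inner_matA (t : Param d) :
    ρ * inner ℝ t (Matrix.toEuclideanCLM (𝕜 := ℝ) (matA h ρ θ₀ G₂) t) =
      ∫ x, Real.sigmoid (linPred h θ₀ x + Real.log ρ) * inner ℝ t (design h x) ^ 2 ∂G₂ := by
  have h1 : ∀ x, Real.sigmoid (linPred h θ₀ x + Real.log ρ) * inner ℝ t (design h x) ^ 2 =
      ∑ i, ∑ j, t i * t j *
        (Real.sigmoid (linPred h θ₀ x + Real.log ρ) * (design h x i * design h x j)) := by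
    intro x
    rw [PiLp.inner_apply, sq, Finset.sum_mul_sum, Finset.mul_sum]
    refine Finset.sum_congr rfl fun i _ => ?_
    rw [Finset.mul_sum]
    refine Finset.sum_congr rfl fun j _ => ?_
    simp only [RCLike.inner_apply, conj_trivial]
    ring
  simp only [h1]
  rw [integral_finsetSum _ fun i _ => integrable_finsetSum _ fun j _ =>
    (H.integrable_entry i j).const_mul _, Matrix.inner_toEuclideanCLM]
  simp only [dotProduct, Matrix.mulVec, Finset.mul_sum]
  refine Finset.sum_congr rfl fun i _ => ?_
  rw [integral_finsetSum _ fun j _ => (H.integrable_entry i j).const_mul _]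
  refine Finset.sum_congr rfl fun j _ => ?_
  rw [integral_const_mul, ← mul_matA_apply H.pos]
  ring

/-- The first column of `A`. -/
lemma mul_dotProduct_matA_col (t : Param d) :
    ρ * ∑ i, t i * matA h ρ θ₀ G₂ i 0 =
      ∫ x, Real.sigmoid (linPred h θ₀ x + Real.log ρ) * inner ℝ t (design h x) ∂G₂ := by
  have h1 : ∀ x, Real.sigmoid (linPred h θ₀ x + Real.log ρ) * inner ℝ t (design h x) =
      ∑ i, t i *
        (Real.sigmoid (linPred h θ₀ x + Real.log ρ) * (design h x i * design h x 0)) := by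
    intro x
    rw [PiLp.inner_apply, Finset.mul_sum]
    refine Finset.sum_congr rfl fun i _ => ?_
    simp only [RCLike.inner_apply, conj_trivial, design_apply_zero]
    ring
  simp only [h1]
  rw [integral_finsetSum _ fun i _ => (H.integrable_entry i 0).const_mul _, Finset.mul_sum]
  refine Finset.sum_congr rfl fun i _ => ?_
  rw [integral_const_mul, ← mul_matA_apply H.pos]
  ring

omit H in
lemma matA_comm (i j : Fin (d + 1)) : matA h ρ θ₀ G₂ i j = matA h ρ θ₀ G₂ j i := by
  simp only [matA, Matrix.of_apply]
  congr 1
  funext x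
  ring

omit H in
lemma isHermitian_matA : (matA h ρ θ₀ G₂).IsHermitian := by
  ext i j
  simp [matA_comm i j]

lemma posSemidef_matA : (matA h ρ θ₀ G₂).PosSemidef := by
  refine Matrix.PosSemidef.of_dotProduct_mulVec_nonneg isHermitian_matA fun t => ?_
  have h1 := H.mul_inner_matA (WithLp.toLp 2 t)
  rw [Matrix.inner_toEuclideanCLM] at h1
  have h2 : 0 ≤ ρ * (t ⬝ᵥ Matrix.mulVec (matA h ρ θ₀ G₂) t) := by
    rw [h1]
    exact integral_nonneg fun x => mul_nonneg (Real.sigmoid_nonneg _) (sq_nonneg _)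
  simpa using nonneg_of_mul_nonneg_right h2 H.pos

variable [IsProbabilityMeasure G₁] [IsProbabilityMeasure G₂]

/-- The variance of the score in the direction `t`. -/
lemma inner_matV (t : Param d) :
    inner ℝ t (Matrix.toEuclideanCLM (𝕜 := ℝ) (matV h ρ θ₀ G₂) t) =
      ρ / (1 + ρ) * Var[fun x => inner ℝ t
        ((1 - Real.sigmoid (linPred h θ₀ x + Real.log ρ)) • design h x); G₁]
      + 1 / (1 + ρ) * Var[fun x => inner ℝ t
        (-(Real.sigmoid (linPred h θ₀ x + Real.log ρ) • design h x)); G₂] := by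
  have hρ := H.pos
  have hz := measurable_design H.meas
  have hs := measurable_sigmoid_linPred H.meas θ₀ (Real.log ρ)
  have hright : MemLp (fun x => -(Real.sigmoid (linPred h θ₀ x + Real.log ρ) • design h x)) 2 G₂ :=
    H.memLp_right.neg
  rw [variance_eq_sub (H.memLp_left.const_inner t), variance_eq_sub (hright.const_inner t)]
  simp only [Pi.pow_apply, inner_neg_right, real_inner_smul_right, neg_sq]
  rw [integral_neg, ← H.mul_dotProduct_matA_col]
  have hm₁ := H.model.integral_one_sub_sigmoid H.meas hρ fun x => inner ℝ t (design h x)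
  have hv₁ := H.model.integral_one_sub_sigmoid H.meas hρ fun x =>
    (1 - Real.sigmoid (linPred h θ₀ x + Real.log ρ)) * inner ℝ t (design h x) ^ 2
  simp only [smul_eq_mul] at hm₁ hv₁
  rw [← H.mul_dotProduct_matA_col] at hm₁
  have hv₁' : ∫ x, ((1 - Real.sigmoid (linPred h θ₀ x + Real.log ρ))
      * inner ℝ t (design h x)) ^ 2 ∂G₁ =
      ∫ x, (1 - Real.sigmoid (linPred h θ₀ x + Real.log ρ)) *
        ((1 - Real.sigmoid (linPred h θ₀ x + Real.log ρ)) * inner ℝ t (design h x) ^ 2) ∂G₁ := by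
    congr 1; funext x; ring
  have hq : ∀ x, inner ℝ t (design h x) ^ 2 ≤ ‖t‖ ^ 2 * ‖design h x‖ ^ 2 := fun x => by
    rw [← mul_pow, ← sq_abs]
    gcongr
    exact abs_real_inner_le_norm _ _
  have hint : Integrable (fun x => ‖t‖ ^ 2 *
      (Real.sigmoid (linPred h θ₀ x + Real.log ρ) * ‖design h x‖ ^ 2)) G₂ :=
    H.integrable_sigmoid.const_mul _
  have hi₁ : Integrable (fun x => Real.sigmoid (linPred h θ₀ x + Real.log ρ) *
      ((1 - Real.sigmoid (linPred h θ₀ x + Real.log ρ)) * inner ℝ t (design h x) ^ 2)) G₂ := by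
    refine hint.mono' (by fun_prop) (ae_of_all _ fun x => ?_)
    have h0 := Real.sigmoid_nonneg (linPred h θ₀ x + Real.log ρ)
    have h1 : 0 ≤ 1 - Real.sigmoid (linPred h θ₀ x + Real.log ρ) :=
      sub_nonneg.2 (Real.sigmoid_le_one _)
    rw [Real.norm_of_nonneg (by positivity)]
    exact (mul_le_mul_of_nonneg_left ((mul_le_of_le_one_left (sq_nonneg _) (by linarith)).trans
      (hq x)) h0).trans (le_of_eq (by ring))
  have hi₂ : Integrable (fun x => (Real.sigmoid (linPred h θ₀ x + Real.log ρ) *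
      inner ℝ t (design h x)) ^ 2) G₂ := by
    refine hint.mono' (by fun_prop) (ae_of_all _ fun x => ?_)
    have h0 := Real.sigmoid_nonneg (linPred h θ₀ x + Real.log ρ)
    have h1 := Real.sigmoid_le_one (linPred h θ₀ x + Real.log ρ)
    rw [Real.norm_of_nonneg (by positivity), mul_pow, sq (Real.sigmoid _), mul_assoc]
    exact (mul_le_mul_of_nonneg_left ((mul_le_of_le_one_left (sq_nonneg _) h1).trans
      (hq x)) h0).trans (le_of_eq (by ring))
  have hsum := H.mul_inner_matA t
  have hsplit : ∫ x, Real.sigmoid (linPred h θ₀ x + Real.log ρ) * inner ℝ t (design h x) ^ 2 ∂G₂ =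
      ∫ x, Real.sigmoid (linPred h θ₀ x + Real.log ρ) *
      ((1 - Real.sigmoid (linPred h θ₀ x + Real.log ρ)) * inner ℝ t (design h x) ^ 2) ∂G₂ +
      ∫ x, (Real.sigmoid (linPred h θ₀ x + Real.log ρ) * inner ℝ t (design h x)) ^ 2 ∂G₂ := by
    rw [← integral_add hi₁ hi₂]
    congr 1; funext x; ring
  rw [hsplit] at hsum
  rw [hm₁, hv₁', hv₁]
  have hV : inner ℝ t (Matrix.toEuclideanCLM (𝕜 := ℝ) (matV h ρ θ₀ G₂) t) =
      ρ / (1 + ρ) * inner ℝ t (Matrix.toEuclideanCLM (𝕜 := ℝ) (matA h ρ θ₀ G₂) t)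
      - ρ * (∑ i, t i * matA h ρ θ₀ G₂ i 0) ^ 2 := by
    simp only [Matrix.inner_toEuclideanCLM, matV, Matrix.sub_mulVec, Matrix.smul_mulVec,
      dotProduct_sub, dotProduct_smul, smul_eq_mul, Matrix.vecMulVec_mulVec, matA_comm 0]
    congr 2
    simp only [dotProduct, sq, Finset.sum_mul_sum]
    simp [Finset.mul_sum, mul_comm, mul_left_comm, mul_assoc]
  rw [hV]
  have hne : 1 + ρ ≠ 0 := by positivity
  generalize (∫ x, Real.sigmoid (linPred h θ₀ x + Real.log ρ) *
      ((1 - Real.sigmoid (linPred h θ₀ x + Real.log ρ)) * inner ℝ t (design h x) ^ 2) ∂G₂) = I₁ at *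
  generalize (∫ x, (Real.sigmoid (linPred h θ₀ x + Real.log ρ) *
      inner ℝ t (design h x)) ^ 2 ∂G₂) = I₂ at *
  generalize inner ℝ t (Matrix.toEuclideanCLM (𝕜 := ℝ) (matA h ρ θ₀ G₂) t) = B at *
  generalize (∑ i, t i * matA h ρ θ₀ G₂ i 0) = a at *
  have hI : I₂ = ρ * B - I₁ := by linarith
  rw [hI]
  field_simp
  ring

end SigmoidMoments

end Moments

lemma norm_le_sum_abs {ι : Type*} [Fintype ι] [DecidableEq ι] (v : EuclideanSpace ℝ ι) :
    ‖v‖ ≤ ∑ i, |v i| := by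
  have h1 := (EuclideanSpace.basisFun ι ℝ).sum_repr v
  calc ‖v‖ = ‖∑ i, v i • EuclideanSpace.basisFun ι ℝ i‖ := by
        conv_lhs => rw [← h1]
        simp
    _ ≤ ∑ i, ‖v i • EuclideanSpace.basisFun ι ℝ i‖ := norm_sum_le _ _
    _ = _ := by simp [norm_smul]

lemma integral_euclideanSpace_apply {𝒳 ι : Type*} [MeasurableSpace 𝒳] [Fintype ι] {G : Measure 𝒳}
    {f : 𝒳 → EuclideanSpace ℝ ι} (hf : Integrable f G) (i : ι) :
    (∫ x, f x ∂G) i = ∫ x, f x i ∂G :=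
  ((EuclideanSpace.proj (𝕜 := ℝ) i).integral_comp_comm hf).symm

/-- Sample sizes whose ratio has a positive limit. -/
lemma tendsto_sampleSize {n₁ n₂ : ℕ → ℕ} {ρ : ℝ} (hρ : 0 < ρ)
    (hn : Tendsto (fun k => n₁ k + n₂ k) atTop atTop)
    (hratio : Tendsto (fun k => (n₁ k : ℝ) / (n₂ k : ℝ)) atTop (𝓝 ρ)) :
    Tendsto n₁ atTop atTop ∧ Tendsto n₂ atTop atTop ∧
    Tendsto (fun k => (n₁ k : ℝ) / ((n₁ k + n₂ k : ℕ) : ℝ)) atTop (𝓝 (ρ / (1 + ρ))) ∧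
    Tendsto (fun k => (n₂ k : ℝ) / ((n₁ k + n₂ k : ℕ) : ℝ)) atTop (𝓝 (1 / (1 + ρ))) := by
  have hpos : ∀ᶠ k in atTop, 0 < n₁ k ∧ 0 < n₂ k := by
    filter_upwards [hratio.eventually_const_lt hρ] with k hk
    constructor
    · rcases Nat.eq_zero_or_pos (n₁ k) with h0 | h0
      · simp [h0] at hk
      · exact h0
    · rcases Nat.eq_zero_or_pos (n₂ k) with h0 | h0
      · simp [h0] at hk
      · exact h0
  have hne : (1 : ℝ) + ρ ≠ 0 := by positivity
  have l₁ : Tendsto (fun k => (n₁ k : ℝ) / ((n₁ k + n₂ k : ℕ) : ℝ)) atTop (𝓝 (ρ / (1 + ρ))) := by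
    refine (hratio.div (hratio.const_add 1) hne).congr' ?_
    filter_upwards [hpos] with k hk
    have h1 : (0 : ℝ) < n₁ k := by exact_mod_cast hk.1
    have h2 : (0 : ℝ) < n₂ k := by exact_mod_cast hk.2
    simp only [Pi.div_apply]
    push_cast
    field_simp
    ring
  have l₂ : Tendsto (fun k => (n₂ k : ℝ) / ((n₁ k + n₂ k : ℕ) : ℝ)) atTop (𝓝 (1 / (1 + ρ))) := by
    refine ((tendsto_const_nhds (x := (1 : ℝ))).div (hratio.const_add 1) hne).congr' ?_
    filter_upwards [hpos] with k hk
    have h1 : (0 : ℝ) < n₁ k := by exact_mod_cast hk.1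
    have h2 : (0 : ℝ) < n₂ k := by exact_mod_cast hk.2
    simp only [Pi.div_apply]
    push_cast
    field_simp
    ring
  have hN : Tendsto (fun k => ((n₁ k + n₂ k : ℕ) : ℝ)) atTop atTop :=
    tendsto_natCast_atTop_atTop.comp hn
  refine ⟨?_, ?_, l₁, l₂⟩
  · refine (tendsto_natCast_atTop_iff (R := ℝ)).1 ?_
    refine (l₁.pos_mul_atTop (by positivity) hN).congr' ?_
    filter_upwards [hN.eventually_gt_atTop 0] with k hk
    field_simp
  · refine (tendsto_natCast_atTop_iff (R := ℝ)).1 ?_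
    refine (l₂.pos_mul_atTop (by positivity) hN).congr' ?_
    filter_upwards [hN.eventually_gt_atTop 0] with k hk
    field_simp

/-- The effect of perturbing the argument of the sigmoid weight by `e` vanishes in `L²`. -/
lemma sq_sigmoid_sub_mul_le {𝒳 : Type*} {d : ℕ} {h : 𝒳 → Fin d → ℝ} {θ₀ : Param d}
    (γ e : ℝ) {C : ℝ} {a : ℝ} {x : 𝒳} (ha : |a| ≤ C * ‖design h x‖) :
    ((Real.sigmoid (linPred h θ₀ x + γ + e) - Real.sigmoid (linPred h θ₀ x + γ)) * a) ^ 2 ≤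
      (|e| * Real.exp |e| * C) ^ 2 *
        (sigmoidDeriv (linPred h θ₀ x + γ) * ‖design h x‖ ^ 2) := by
  have h1 := abs_sigmoid_add_sub_le (linPred h θ₀ x + γ) e
  have hp := sigmoidDeriv_pos (linPred h θ₀ x + γ)
  have hp1 := sigmoidDeriv_le_one (linPred h θ₀ x + γ)
  have h2 : |(Real.sigmoid (linPred h θ₀ x + γ + e) - Real.sigmoid (linPred h θ₀ x + γ)) * a| ≤
      (|e| * Real.exp |e| * sigmoidDeriv (linPred h θ₀ x + γ)) * (C * ‖design h x‖) := by
    rw [abs_mul]; gcongr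
  rw [← sq_abs]
  calc _ ≤ ((|e| * Real.exp |e| * sigmoidDeriv (linPred h θ₀ x + γ)) * (C * ‖design h x‖)) ^ 2 := by
        gcongr
    _ = (|e| * Real.exp |e| * C) ^ 2 * (sigmoidDeriv (linPred h θ₀ x + γ) ^ 2
        * ‖design h x‖ ^ 2) := by ring
    _ ≤ _ := by
        gcongr
        rw [sq]
        exact mul_le_of_le_one_left hp.le hp1

lemma inner_toEuclideanCLM_comm {ι : Type*} [Fintype ι] [DecidableEq ι] {M : Matrix ι ι ℝ}
    (hM : M.IsHermitian) (t u : EuclideanSpace ℝ ι) :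
    inner ℝ t (Matrix.toEuclideanCLM (𝕜 := ℝ) M u) =
      inner ℝ (Matrix.toEuclideanCLM (𝕜 := ℝ) M t) u := by
  rw [Matrix.inner_toEuclideanCLM, real_inner_comm, Matrix.inner_toEuclideanCLM,
    Matrix.dotProduct_mulVec, ← Matrix.mulVec_transpose]
  have h1 := hM.eq
  rw [Matrix.conjTranspose_eq_transpose_of_trivial] at h1
  rw [h1, dotProduct_comm]

namespace SigmoidMoments

variable {𝒳 : Type*} [MeasurableSpace 𝒳] {d : ℕ} {h : 𝒳 → Fin d → ℝ} {θ₀ : Param d}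
  {G₁ G₂ : Measure 𝒳} {ρ : ℝ}

section Matrices

variable (H : SigmoidMoments h θ₀ ρ G₁ G₂)
include H

lemma posDef_matS (hA : IsUnit (matA h ρ θ₀ G₂)) : (matS h ρ θ₀ G₂).PosDef := by
  have hρ := H.pos
  exact (H.posSemidef_matA.posDef_iff_isUnit.2 hA).smul (show 0 < ρ / (1 + ρ) by positivity)

lemma posSemidef_matV [IsProbabilityMeasure G₁] [IsProbabilityMeasure G₂] :
    (matV h ρ θ₀ G₂).PosSemidef := by
  have hρ := H.pos
  refine Matrix.PosSemidef.of_dotProduct_mulVec_nonneg ?_ fun t => ?_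
  · ext i j
    simp [matV, Matrix.vecMulVec_apply, matA_comm (h := h) (θ₀ := θ₀) (G₂ := G₂) (ρ := ρ) j i,
      matA_comm (h := h) (θ₀ := θ₀) (G₂ := G₂) (ρ := ρ) 0, mul_comm]
  · have h1 := H.inner_matV (WithLp.toLp 2 t)
    rw [Matrix.inner_toEuclideanCLM] at h1
    have h2 : 0 ≤ t ⬝ᵥ Matrix.mulVec (matV h ρ θ₀ G₂) t := by
      rw [h1]
      have := variance_nonneg (fun x => inner ℝ (WithLp.toLp 2 t : Param d)
        ((1 - Real.sigmoid (linPred h θ₀ x + Real.log ρ)) • design h x)) G₁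
      have := variance_nonneg (fun x => inner ℝ (WithLp.toLp 2 t : Param d)
        (-(Real.sigmoid (linPred h θ₀ x + Real.log ρ) • design h x))) G₂
      positivity
    simpa using h2

lemma isHermitian_inv_matS (hA : IsUnit (matA h ρ θ₀ G₂)) : (matS h ρ θ₀ G₂)⁻¹.IsHermitian :=
  (H.posDef_matS hA).inv.isHermitian

lemma posSemidef_asympCov [IsProbabilityMeasure G₁] [IsProbabilityMeasure G₂]
    (hA : IsUnit (matA h ρ θ₀ G₂)) : (asympCov h ρ θ₀ G₂).PosSemidef := by
  have h1 := H.posSemidef_matV.mul_mul_conjTranspose_same (matS h ρ θ₀ G₂)⁻¹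
  rwa [(H.isHermitian_inv_matS hA).eq] at h1

lemma inner_inv_matS_comm (hA : IsUnit (matA h ρ θ₀ G₂)) (t u : Param d) :
    inner ℝ t (Matrix.toEuclideanCLM (𝕜 := ℝ) (matS h ρ θ₀ G₂)⁻¹ u) =
      inner ℝ (Matrix.toEuclideanCLM (𝕜 := ℝ) (matS h ρ θ₀ G₂)⁻¹ t) u :=
  inner_toEuclideanCLM_comm (H.isHermitian_inv_matS hA) t u

lemma inner_asympCov (hA : IsUnit (matA h ρ θ₀ G₂)) (t : Param d) :
    inner ℝ t (Matrix.toEuclideanCLM (𝕜 := ℝ) (asympCov h ρ θ₀ G₂) t) =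
      inner ℝ (Matrix.toEuclideanCLM (𝕜 := ℝ) (matS h ρ θ₀ G₂)⁻¹ t)
        (Matrix.toEuclideanCLM (𝕜 := ℝ) (matV h ρ θ₀ G₂)
          (Matrix.toEuclideanCLM (𝕜 := ℝ) (matS h ρ θ₀ G₂)⁻¹ t)) := by
  rw [← H.inner_inv_matS_comm hA, asympCov, map_mul, map_mul]
  rfl

lemma matS_inv_apply (hA : IsUnit (matA h ρ θ₀ G₂)) (u : Param d) :
    Matrix.toEuclideanCLM (𝕜 := ℝ) (matS h ρ θ₀ G₂)
      (Matrix.toEuclideanCLM (𝕜 := ℝ) (matS h ρ θ₀ G₂)⁻¹ u) = u := by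
  have h1 : matS h ρ θ₀ G₂ * (matS h ρ θ₀ G₂)⁻¹ = 1 :=
    Matrix.mul_nonsing_inv _ ((Matrix.isUnit_iff_isUnit_det _).1 (H.posDef_matS hA).isUnit)
  have h2 := congrArg (Matrix.toEuclideanCLM (𝕜 := ℝ)) h1
  rw [map_mul, map_one] at h2
  exact congrArg (fun T => T u) h2

end Matrices

section Score

variable {Ω : Type*} [MeasurableSpace Ω] {P : Measure Ω} [IsProbabilityMeasure P]
  [IsProbabilityMeasure G₁] [IsProbabilityMeasure G₂] {X₁ X₂ : ℕ → Ω → 𝒳}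

/-- The normalized score, transformed by a linear map, differs by a term vanishing in probability
from a normalized centered sum with fixed summands. -/
lemma tendstoInMeasure_score_sub (H : SigmoidMoments h θ₀ ρ G₁ G₂)
    (hX₁ : ∀ j, HasLaw (X₁ j) G₁ P) (hX₂ : ∀ j, HasLaw (X₂ j) G₂ P)
    (hindep : iIndepFun (fun s : ℕ ⊕ ℕ => Sum.elim X₁ X₂ s) P)
    {n₁ n₂ : ℕ → ℕ} (hn : Tendsto (fun k => n₁ k + n₂ k) atTop atTop)
    (hratio : Tendsto (fun k => (n₁ k : ℝ) / (n₂ k : ℝ)) atTop (𝓝 ρ))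
    (L : Param d →L[ℝ] Param d) :
    TendstoInMeasure P (fun k ω =>
      (√((n₁ k + n₂ k : ℕ) : ℝ))⁻¹ • L (score h θ₀ (Real.log (n₁ k / n₂ k)) (n₁ k) (n₂ k)
        (fun j => X₁ j ω) (fun j => X₂ j ω))
      - (√((n₁ k + n₂ k : ℕ) : ℝ))⁻¹ •
      (∑ j ∈ Finset.range (n₁ k),
          (L ((1 - Real.sigmoid (linPred h θ₀ (X₁ j ω) + Real.log ρ)) • design h (X₁ j ω))
            - ∫ x, L ((1 - Real.sigmoid (linPred h θ₀ x + Real.log ρ)) • design h x) ∂G₁)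
        + ∑ j ∈ Finset.range (n₂ k),
          (L (-(Real.sigmoid (linPred h θ₀ (X₂ j ω) + Real.log ρ) • design h (X₂ j ω)))
            - ∫ x, L (-(Real.sigmoid (linPred h θ₀ x + Real.log ρ) • design h x)) ∂G₂)))
      atTop 0 := by
  obtain ⟨hn₁, hn₂, -, -⟩ := tendsto_sampleSize H.pos hn hratio
  have hz := measurable_design H.meas
  set σ : 𝒳 → ℝ := fun x => Real.sigmoid (linPred h θ₀ x + Real.log ρ) with hσ
  set τ : ℕ → 𝒳 → ℝ := fun k x => Real.sigmoid (linPred h θ₀ x + Real.log (n₁ k / n₂ k)) with hτ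
  set N : ℕ → ℝ := fun k => ((n₁ k + n₂ k : ℕ) : ℝ) with hN
  have hσm : Measurable σ := measurable_sigmoid_linPred H.meas θ₀ _
  have hτm : ∀ k, Measurable (τ k) := fun k => measurable_sigmoid_linPred H.meas θ₀ _
  set y : 𝒳 → Param d := fun x => L (design h x) with hy
  have hym : Measurable y := L.measurable.comp hz
  have hyi : ∀ i, Measurable fun x => y x i := fun i =>
    (EuclideanSpace.proj (𝕜 := ℝ) i).measurable.comp hym
  have hyle : ∀ x i, |y x i| ≤ ‖L‖ * ‖design h x‖ := fun x i =>
    (PiLp.norm_apply_le (y x) i).trans (L.le_opNorm _)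
  set e : ℕ → ℝ := fun k => Real.log (n₁ k / n₂ k) - Real.log ρ with he
  have helim : Tendsto e atTop (𝓝 0) := by
    have := ((Real.continuousAt_log H.pos.ne').tendsto.comp hratio).sub_const (Real.log ρ)
    simpa using this
  have hτe : ∀ k x, τ k x = Real.sigmoid (linPred h θ₀ x + Real.log ρ + e k) := fun k x => by
    simp only [hτ, he]; congr 1; ring
  set g : Fin (d + 1) → ℕ → 𝒳 → ℝ := fun i k x => (τ k x - σ x) * y x i with hg
  have hgm : ∀ i k, Measurable (g i k) := fun i k => ((hτm k).sub hσm).mul (hyi i)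
  have hgsq : ∀ i k x, g i k x ^ 2 ≤ (|e k| * Real.exp |e k| * ‖L‖) ^ 2 *
      (sigmoidDeriv (linPred h θ₀ x + Real.log ρ) * ‖design h x‖ ^ 2) := fun i k x => by
    simp only [hg, hτe]
    exact sq_sigmoid_sub_mul_le _ _ (hyle x i)
  have hcoef : Tendsto (fun k => (|e k| * Real.exp |e k| * ‖L‖) ^ 2) atTop (𝓝 0) := by
    have h1 : Continuous fun t : ℝ => (|t| * Real.exp |t| * ‖L‖) ^ 2 := by fun_prop
    have := (h1.tendsto 0).comp helim
    simpa [Function.comp_def] using this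
  have hint : ∀ {G : Measure 𝒳}, Integrable (fun x =>
      sigmoidDeriv (linPred h θ₀ x + Real.log ρ) * ‖design h x‖ ^ 2) G → ∀ i k,
      Integrable (fun x => g i k x ^ 2) G := fun hG i k =>
    (hG.const_mul _).mono' ((hgm i k).pow_const 2).aestronglyMeasurable
      (ae_of_all _ fun x => by
        rw [Real.norm_of_nonneg (sq_nonneg _)]; exact hgsq i k x)
  have hg2 : ∀ {G : Measure 𝒳}, Integrable (fun x =>
      sigmoidDeriv (linPred h θ₀ x + Real.log ρ) * ‖design h x‖ ^ 2) G → ∀ i k,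
      MemLp (g i k) 2 G := fun hG i k =>
    (memLp_two_iff_integrable_sq (hgm i k).aestronglyMeasurable).2 (hint hG i k)
  have hglim : ∀ {G : Measure 𝒳}, Integrable (fun x =>
      sigmoidDeriv (linPred h θ₀ x + Real.log ρ) * ‖design h x‖ ^ 2) G → ∀ i,
      Tendsto (fun k => ∫ x, g i k x ^ 2 ∂G) atTop (𝓝 0) := fun {G} hG i => by
    have h1 := hcoef.mul_const
      (∫ x, sigmoidDeriv (linPred h θ₀ x + Real.log ρ) * ‖design h x‖ ^ 2 ∂G)
    rw [zero_mul] at h1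
    refine squeeze_zero (fun k => integral_nonneg fun x => sq_nonneg _) (fun k => ?_) h1
    rw [← integral_const_mul]
    exact integral_mono (hint hG i k) (hG.const_mul _) fun x => hgsq i k x
  set F : Fin (d + 1) ⊕ Fin (d + 1) → ℕ → Ω → ℝ := Sum.elim
    (fun i k ω => (√(N k))⁻¹ * ∑ j ∈ Finset.range (n₁ k), (g i k (X₁ j ω) - ∫ x, g i k x ∂G₁))
    (fun i k ω => (√(N k))⁻¹ * ∑ j ∈ Finset.range (n₂ k), (g i k (X₂ j ω) - ∫ x, g i k x ∂G₂))
    with hF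
  have hFlim : ∀ s, TendstoInMeasure P (F s) atTop 0 := by
    rintro (i | i)
    · exact tendstoInMeasure_centered_sum hX₁ (iIndepFun_left hindep) (hgm i)
        (hg2 H.int_deriv₁ i) (hglim H.int_deriv₁ i) fun k => by simp [hN]
    · exact tendstoInMeasure_centered_sum hX₂ (iIndepFun_right hindep) (hgm i)
        (hg2 H.int_deriv₂ i) (hglim H.int_deriv₂ i) fun k => by simp [hN]
  refine tendstoInMeasure_zero_of_norm_le_sum hFlim ?_
  have hη₁ : Integrable (fun x => L ((1 - σ x) • design h x)) G₁ :=
    L.integrable_comp (H.memLp_left.integrable (by norm_num))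
  have hη₂ : Integrable (fun x => L (-(σ x • design h x))) G₂ :=
    L.integrable_comp (H.memLp_right.neg.integrable (by norm_num))
  filter_upwards [hn₁.eventually_gt_atTop 0, hn₂.eventually_gt_atTop 0] with k hk₁ hk₂ ω
  have hk₁' : (0 : ℝ) < n₁ k := by exact_mod_cast hk₁
  have hk₂' : (0 : ℝ) < n₂ k := by exact_mod_cast hk₂
  refine (norm_le_sum_abs _).trans ?_
  rw [Fintype.sum_sum_type, ← Finset.sum_add_distrib]
  refine Finset.sum_le_sum fun i _ => ?_
  simp only [hF, Sum.elim_inl, Sum.elim_inr, Real.norm_eq_abs]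
  rw [← abs_neg]
  refine le_trans (le_of_eq ?_) (abs_add_le _ _)
  congr 1
  have hI₁ : (∫ x, L ((1 - σ x) • design h x) ∂G₁) i = ∫ x, (1 - σ x) * y x i ∂G₁ := by
    rw [integral_euclideanSpace_apply hη₁]
    simp [hy]
  have hI₂ : (∫ x, L (-(σ x • design h x)) ∂G₂) i = -∫ x, σ x * y x i ∂G₂ := by
    rw [integral_euclideanSpace_apply hη₂, ← integral_neg]
    simp [hy]
  have hi₁ : Integrable (fun x => (1 - σ x) * y x i) G₁ := by
    have := (EuclideanSpace.proj (𝕜 := ℝ) i).integrable_comp hη₁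
    simpa [hy] using this
  have hi₂ : Integrable (fun x => σ x * y x i) G₂ := by
    have := ((EuclideanSpace.proj (𝕜 := ℝ) i).integrable_comp hη₂).neg
    simpa [hy, Pi.neg_def] using this
  have hg₁ : ∫ x, g i k x ∂G₁ = ∫ x, (1 - σ x) * y x i ∂G₁ - ∫ x, (1 - τ k x) * y x i ∂G₁ := by
    have h1 := (hg2 H.int_deriv₁ i k).integrable (by norm_num)
    have h2 : ∫ x, (1 - τ k x) * y x i ∂G₁ = ∫ x, ((1 - σ x) * y x i - g i k x) ∂G₁ := by
      congr 1; funext x; simp only [hg]; ring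
    rw [h2, integral_sub hi₁ h1]; ring
  have hg₂ : ∫ x, g i k x ∂G₂ = ∫ x, τ k x * y x i ∂G₂ - ∫ x, σ x * y x i ∂G₂ := by
    have h1 := (hg2 H.int_deriv₂ i k).integrable (by norm_num)
    have h2 : ∫ x, τ k x * y x i ∂G₂ = ∫ x, (σ x * y x i + g i k x) ∂G₂ := by
      congr 1; funext x; simp only [hg]; ring
    rw [h2, integral_add hi₂ h1]; ring
  have hbal := H.model.integral_one_sub_sigmoid H.meas (div_pos hk₁' hk₂') fun x => y x i
  simp only [smul_eq_mul] at hbal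
  have hbal' : (n₁ k : ℝ) * ∫ x, (1 - τ k x) * y x i ∂G₁ = n₂ k * ∫ x, τ k x * y x i ∂G₂ := by
    rw [hbal]; field_simp; rfl
  rw [← mul_add]
  simp only [PiLp.sub_apply, PiLp.smul_apply, smul_eq_mul, PiLp.add_apply, score, sampleSum,
    map_add, map_sum, map_neg, map_smul, hg₁, hg₂, Finset.sum_sub_distrib, Finset.sum_const,
    Finset.card_range, nsmul_eq_mul]
  rw [← mul_sub, ← mul_neg]
  congr 1
  simp only [map_smul, map_neg] at hI₁ hI₂
  have hS₁ : ∑ j ∈ Finset.range (n₁ k), g i k (X₁ j ω) =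
      ∑ j ∈ Finset.range (n₁ k), (1 - σ (X₁ j ω)) * y (X₁ j ω) i
      - ∑ j ∈ Finset.range (n₁ k), (1 - τ k (X₁ j ω)) * y (X₁ j ω) i := by
    rw [← Finset.sum_sub_distrib]
    refine Finset.sum_congr rfl fun j _ => ?_
    simp only [hg]; ring
  have hS₂ : ∑ j ∈ Finset.range (n₂ k), g i k (X₂ j ω) =
      ∑ j ∈ Finset.range (n₂ k), -(σ (X₂ j ω) * y (X₂ j ω) i)
      - ∑ j ∈ Finset.range (n₂ k), -(τ k (X₂ j ω) * y (X₂ j ω) i) := by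
    rw [← Finset.sum_sub_distrib]
    refine Finset.sum_congr rfl fun j _ => ?_
    simp only [hg]; ring
  rw [hS₁, hS₂]
  simp only [hσ, hτ, hy] at hI₁ hI₂ hbal' ⊢
  rw [hI₁, hI₂]
  simp only [WithLp.ofLp_sum, Finset.sum_apply, PiLp.smul_apply, PiLp.neg_apply, smul_eq_mul]
  linear_combination -hbal'

omit [IsProbabilityMeasure P] [IsProbabilityMeasure G₁] [IsProbabilityMeasure G₂] in
lemma aemeasurable_score (H : SigmoidMoments h θ₀ ρ G₁ G₂)
    (hX₁ : ∀ j, AEMeasurable (X₁ j) P) (hX₂ : ∀ j, AEMeasurable (X₂ j) P) (γ : ℝ) (m₁ m₂ : ℕ) :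
    AEMeasurable (fun ω => score h θ₀ γ m₁ m₂ (fun j => X₁ j ω) (fun j => X₂ j ω)) P := by
  have hz := measurable_design H.meas
  have hσ := measurable_sigmoid_linPred H.meas θ₀ γ
  have h₁ : Measurable fun x => (1 - Real.sigmoid (linPred h θ₀ x + γ)) • design h x := by fun_prop
  have h₂ : Measurable fun x => -(Real.sigmoid (linPred h θ₀ x + γ) • design h x) := by fun_prop
  exact (Finset.aemeasurable_fun_sum _ fun j _ => h₁.comp_aemeasurable (hX₁ j)).add
    (Finset.aemeasurable_fun_sum _ fun j _ => h₂.comp_aemeasurable (hX₂ j))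

/-- Asymptotic normality of `S⁻¹` times the normalized score. -/
lemma tendstoInDistribution_score (H : SigmoidMoments h θ₀ ρ G₁ G₂)
    (hA : IsUnit (matA h ρ θ₀ G₂))
    (hX₁ : ∀ j, HasLaw (X₁ j) G₁ P) (hX₂ : ∀ j, HasLaw (X₂ j) G₂ P)
    (hindep : iIndepFun (fun s : ℕ ⊕ ℕ => Sum.elim X₁ X₂ s) P)
    {n₁ n₂ : ℕ → ℕ} (hn : Tendsto (fun k => n₁ k + n₂ k) atTop atTop)
    (hratio : Tendsto (fun k => (n₁ k : ℝ) / (n₂ k : ℝ)) atTop (𝓝 ρ)) :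
    TendstoInDistribution (fun k ω => (√((n₁ k + n₂ k : ℕ) : ℝ))⁻¹ •
      Matrix.toEuclideanCLM (𝕜 := ℝ) (matS h ρ θ₀ G₂)⁻¹
        (score h θ₀ (Real.log (n₁ k / n₂ k)) (n₁ k) (n₂ k) (fun j => X₁ j ω) (fun j => X₂ j ω)))
      atTop id (fun _ => P) (multivariateGaussian (0 : Param d) (asympCov h ρ θ₀ G₂)) := by
  obtain ⟨hn₁, hn₂, hp₁, hp₂⟩ := tendsto_sampleSize H.pos hn hratio
  have hz := measurable_design H.meas
  have hσ := measurable_sigmoid_linPred H.meas θ₀ (Real.log ρ)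
  set L := Matrix.toEuclideanCLM (𝕜 := ℝ) (matS h ρ θ₀ G₂)⁻¹ with hL
  have hright : MemLp (fun x => -(Real.sigmoid (linPred h θ₀ x + Real.log ρ) • design h x)) 2 G₂ :=
    H.memLp_right.neg
  have clt := tendstoInDistribution_two_sample hX₁ hX₂ hindep
    (η₁ := fun x => L ((1 - Real.sigmoid (linPred h θ₀ x + Real.log ρ)) • design h x))
    (η₂ := fun x => L (-(Real.sigmoid (linPred h θ₀ x + Real.log ρ) • design h x)))
    (by fun_prop) (by fun_prop) (L.comp_memLp' H.memLp_left) (L.comp_memLp' hright)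
    (N := fun k => ((n₁ k + n₂ k : ℕ) : ℝ)) (fun k => Nat.cast_nonneg _) hn₁ hn₂ hp₁ hp₂
    (H.posSemidef_asympCov hA) (fun t => by
      rw [← Matrix.inner_toEuclideanCLM, H.inner_asympCov hA, H.inner_matV]
      simp only [hL, H.inner_inv_matS_comm hA])
  refine tendstoInDistribution_of_tendstoInMeasure_sub _ _ clt
    (H.tendstoInMeasure_score_sub hX₁ hX₂ hindep hn hratio L) fun k => ?_
  have := H.aemeasurable_score (fun j => (hX₁ j).aemeasurable) (fun j => (hX₂ j).aemeasurable)
    (Real.log (n₁ k / n₂ k)) (n₁ k) (n₂ k)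
  fun_prop

end Score

end SigmoidMoments

section Remainders

variable {𝒳 : Type*} [MeasurableSpace 𝒳] {d : ℕ} {h : 𝒳 → Fin d → ℝ} {θ₀ : Param d}
  {G₁ G₂ : Measure 𝒳} {ρ : ℝ}
  {Ω : Type*} [MeasurableSpace Ω] {P : Measure Ω} [IsProbabilityMeasure P]
  {X₁ X₂ : ℕ → Ω → 𝒳} {n₁ n₂ : ℕ → ℕ}

omit [MeasurableSpace 𝒳] in
lemma hessianModulus_nonneg {K : 𝒳 → ℝ} (hK : ∀ x, 0 ≤ K x) {δ : ℝ} (hδ : 0 ≤ δ) (x : 𝒳) :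
    0 ≤ hessianModulus h K δ x :=
  le_min (mul_nonneg (sub_nonneg.2 (Real.one_le_exp (by positivity))) (hK x))
    (mul_nonneg zero_le_two (hK x))

lemma aestronglyMeasurable_hessianModulus (hh : Measurable h) {G : Measure 𝒳} {K : 𝒳 → ℝ}
    (hK : AEStronglyMeasurable K G) (δ : ℝ) :
    AEStronglyMeasurable (hessianModulus h K δ) G := by
  have hz := measurable_design hh
  have h1 : AEMeasurable (fun x => (Real.exp (δ * ‖design h x‖) - 1) * K x) G := by
    have := hK.aemeasurable
    fun_prop
  exact (h1.min (hK.aemeasurable.const_mul 2)).aestronglyMeasurable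

omit [MeasurableSpace 𝒳] in
lemma norm_hessianModulus_le {K : 𝒳 → ℝ} (hK : ∀ x, 0 ≤ K x) {δ : ℝ} (hδ : 0 ≤ δ) (x : 𝒳) :
    ‖hessianModulus h K δ x‖ ≤ 2 * K x := by
  rw [Real.norm_of_nonneg (hessianModulus_nonneg hK hδ x)]
  exact min_le_right _ _

lemma tendsto_integral_hessianModulus (hh : Measurable h) {G : Measure 𝒳} {K : 𝒳 → ℝ}
    (hKi : Integrable K G) (hK : ∀ x, 0 ≤ K x) {δ : ℕ → ℝ} (hδ0 : ∀ k, 0 ≤ δ k)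
    (hδ : Tendsto δ atTop (𝓝 0)) :
    Tendsto (fun k => ∫ x, hessianModulus h K (δ k) x ∂G) atTop (𝓝 0) := by
  have h1 := tendsto_integral_of_dominated_convergence (μ := G) (f := fun _ => (0 : ℝ))
    (F := fun k => hessianModulus h K (δ k)) (fun x => 2 * K x)
    (fun k => aestronglyMeasurable_hessianModulus hh hKi.aestronglyMeasurable _)
    (hKi.const_mul 2) (fun k => ae_of_all _ fun x => norm_hessianModulus_le hK (hδ0 k) x)
    (ae_of_all _ fun x => ?_)
  · simpa using h1
  · have hc : Continuous fun t : ℝ => (Real.exp (t * ‖design h x‖) - 1) * K x := by fun_prop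
    have h2 := (hc.tendsto 0).comp hδ
    simp only [zero_mul, Real.exp_zero, sub_self] at h2
    exact squeeze_zero (fun k => hessianModulus_nonneg hK (hδ0 k) x)
      (fun k => min_le_left _ _) h2

lemma tendstoInMeasure_hessianModulus (hh : Measurable h)
    (hX₁ : ∀ j, HasLaw (X₁ j) G₁ P) (hX₂ : ∀ j, HasLaw (X₂ j) G₂ P) {K : 𝒳 → ℝ}
    (hK₁ : Integrable K G₁) (hK₂ : Integrable K G₂) (hK : ∀ x, 0 ≤ K x) {δ : ℕ → ℝ}
    (hδ0 : ∀ k, 0 ≤ δ k) (hδ : Tendsto δ atTop (𝓝 0)) :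
    TendstoInMeasure P (fun k ω => ((n₁ k + n₂ k : ℕ) : ℝ)⁻¹ *
      sampleSum (hessianModulus h K (δ k)) (hessianModulus h K (δ k)) (n₁ k) (n₂ k)
        (fun j => X₁ j ω) (fun j => X₂ j ω)) atTop 0 := by
  have hint : ∀ {G : Measure 𝒳}, Integrable K G → ∀ k, Integrable (hessianModulus h K (δ k)) G :=
    fun hG k => (hG.const_mul 2).mono'
      (aestronglyMeasurable_hessianModulus hh hG.aestronglyMeasurable _)
      (ae_of_all _ fun x => norm_hessianModulus_le hK (hδ0 k) x)
  have l₁ := tendstoInMeasure_avg hX₁ (m := n₁) (N := fun k => ((n₁ k + n₂ k : ℕ) : ℝ))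
    (hint hK₁) (fun k x => hessianModulus_nonneg hK (hδ0 k) x)
    (tendsto_integral_hessianModulus hh hK₁ hK hδ0 hδ) (fun k => by simp)
  have l₂ := tendstoInMeasure_avg hX₂ (m := n₂) (N := fun k => ((n₁ k + n₂ k : ℕ) : ℝ))
    (hint hK₂) (fun k x => hessianModulus_nonneg hK (hδ0 k) x)
    (tendsto_integral_hessianModulus hh hK₂ hK hδ0 hδ) (fun k => by simp)
  simp only [sampleSum, mul_add]
  exact tendstoInMeasure_zero_add l₁ l₂

/-- The total entrywise deviation of the empirical Hessian from `S`. -/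
def hessianDev (h : 𝒳 → Fin d → ℝ) (ρ : ℝ) (θ₀ : Param d) (G₂ : Measure 𝒳) (m₁ m₂ : ℕ)
    (x₁ x₂ : ℕ → 𝒳) : ℝ :=
  ∑ i, ∑ j, |((m₁ + m₂ : ℕ) : ℝ)⁻¹ * sampleSum
    (fun x => sigmoidDeriv (linPred h θ₀ x + Real.log ρ) * (design h x i * design h x j))
    (fun x => sigmoidDeriv (linPred h θ₀ x + Real.log ρ) * (design h x i * design h x j))
    m₁ m₂ x₁ x₂ - matS h ρ θ₀ G₂ i j|

lemma abs_hessian_sub_le (m₁ m₂ : ℕ) (x₁ x₂ : ℕ → 𝒳) (u : Param d) :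
    |((m₁ + m₂ : ℕ) : ℝ)⁻¹ * sampleSum
      (fun x => sigmoidDeriv (linPred h θ₀ x + Real.log ρ) * inner ℝ u (design h x) ^ 2)
      (fun x => sigmoidDeriv (linPred h θ₀ x + Real.log ρ) * inner ℝ u (design h x) ^ 2)
      m₁ m₂ x₁ x₂ - inner ℝ u (Matrix.toEuclideanCLM (𝕜 := ℝ) (matS h ρ θ₀ G₂) u)| ≤
      ‖u‖ ^ 2 * hessianDev h ρ θ₀ G₂ m₁ m₂ x₁ x₂ := by
  have h1 : ∀ x, sigmoidDeriv (linPred h θ₀ x + Real.log ρ) * inner ℝ u (design h x) ^ 2 =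
      ∑ i, ∑ j, u i * u j *
        (sigmoidDeriv (linPred h θ₀ x + Real.log ρ) * (design h x i * design h x j)) := by
    intro x
    rw [PiLp.inner_apply, sq, Finset.sum_mul_sum, Finset.mul_sum]
    refine Finset.sum_congr rfl fun i _ => ?_
    rw [Finset.mul_sum]
    refine Finset.sum_congr rfl fun j _ => ?_
    simp only [RCLike.inner_apply, conj_trivial]
    ring
  have h2 : ∀ (m : ℕ) (x : ℕ → 𝒳), ∑ l ∈ Finset.range m,
      sigmoidDeriv (linPred h θ₀ (x l) + Real.log ρ) * inner ℝ u (design h (x l)) ^ 2 =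
      ∑ i, ∑ j, u i * u j * ∑ l ∈ Finset.range m,
        (sigmoidDeriv (linPred h θ₀ (x l) + Real.log ρ)
          * (design h (x l) i * design h (x l) j)) := by
    intro m x
    simp only [h1, Finset.mul_sum]
    rw [Finset.sum_comm]
    exact Finset.sum_congr rfl fun i _ => Finset.sum_comm
  have h3 : inner ℝ u (Matrix.toEuclideanCLM (𝕜 := ℝ) (matS h ρ θ₀ G₂) u) =
      ∑ i, ∑ j, u i * u j * matS h ρ θ₀ G₂ i j := by
    rw [Matrix.inner_toEuclideanCLM]
    simp only [dotProduct, Matrix.mulVec, Finset.mul_sum]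
    exact Finset.sum_congr rfl fun i _ => Finset.sum_congr rfl fun j _ => by ring
  simp only [hessianDev, sampleSum]
  rw [h2, h2, h3, ← Finset.sum_add_distrib, Finset.mul_sum, Finset.mul_sum,
    ← Finset.sum_sub_distrib]
  refine (Finset.abs_sum_le_sum_abs _ _).trans (Finset.sum_le_sum fun i _ => ?_)
  rw [← Finset.sum_add_distrib, Finset.mul_sum, Finset.mul_sum, ← Finset.sum_sub_distrib]
  refine (Finset.abs_sum_le_sum_abs _ _).trans (Finset.sum_le_sum fun j _ => ?_)
  have h4 : ∀ a b c s n : ℝ, n * (a * b + a * c) - a * s = a * (n * (b + c) - s) := by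
    intros; ring
  rw [h4, abs_mul]
  gcongr
  rw [abs_mul, sq]
  gcongr
  exacts [PiLp.norm_apply_le u i, PiLp.norm_apply_le u j]

lemma SigmoidMoments.tendstoInMeasure_hessianDev (H : SigmoidMoments h θ₀ ρ G₁ G₂)
    (hX₁ : ∀ j, HasLaw (X₁ j) G₁ P) (hX₂ : ∀ j, HasLaw (X₂ j) G₂ P)
    (hindep : iIndepFun (fun s : ℕ ⊕ ℕ => Sum.elim X₁ X₂ s) P)
    (hn : Tendsto (fun k => n₁ k + n₂ k) atTop atTop)
    (hratio : Tendsto (fun k => (n₁ k : ℝ) / (n₂ k : ℝ)) atTop (𝓝 ρ)) :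
    TendstoInMeasure P (fun k ω => hessianDev h ρ θ₀ G₂ (n₁ k) (n₂ k)
        (fun j => X₁ j ω) (fun j => X₂ j ω)) atTop 0 := by
  obtain ⟨hn₁, hn₂, hp₁, hp₂⟩ := tendsto_sampleSize H.pos hn hratio
  set f : Fin (d + 1) → Fin (d + 1) → 𝒳 → ℝ := fun i j x =>
    sigmoidDeriv (linPred h θ₀ x + Real.log ρ) * (design h x i * design h x j) with hf
  have hfm : ∀ i j, Measurable (f i j) := fun i j =>
    (measurable_sigmoidDeriv_linPred H.meas θ₀ _).mul
      ((measurable_design_apply H.meas i).mul (measurable_design_apply H.meas j))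
  have hfi : ∀ {G : Measure 𝒳}, Integrable (fun x =>
      sigmoidDeriv (linPred h θ₀ x + Real.log ρ) * ‖design h x‖ ^ 2) G → ∀ i j,
      Integrable (f i j) G := fun hG i j =>
    hG.mono' (hfm i j).aestronglyMeasurable (ae_of_all _ fun x => by
      rw [norm_mul, Real.norm_of_nonneg (sigmoidDeriv_pos _).le, norm_mul, sq]
      have := (sigmoidDeriv_pos (linPred h θ₀ x + Real.log ρ)).le
      gcongr
      exacts [PiLp.norm_apply_le (design h x) i, PiLp.norm_apply_le (design h x) j])
  have hval : ∀ i j, ρ / (1 + ρ) * ∫ x, f i j x ∂G₁ + 1 / (1 + ρ) * ∫ x, f i j x ∂G₂ =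
      matS h ρ θ₀ G₂ i j := fun i j => by
    have hρ := H.pos
    have h1 := H.model.integral_one_sub_sigmoid H.meas hρ fun x =>
      Real.sigmoid (linPred h θ₀ x + Real.log ρ) * (design h x i * design h x j)
    have h2 : ∫ x, f i j x ∂G₁ = ∫ x, (1 - Real.sigmoid (linPred h θ₀ x + Real.log ρ)) •
        (Real.sigmoid (linPred h θ₀ x + Real.log ρ) * (design h x i * design h x j)) ∂G₁ := by
      congr 1; funext x; simp only [hf, sigmoidDeriv, smul_eq_mul]; ring
    have h3 : ∫ x, Real.sigmoid (linPred h θ₀ x + Real.log ρ) •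
        (Real.sigmoid (linPred h θ₀ x + Real.log ρ) * (design h x i * design h x j)) ∂G₂ =
        ρ * matA h ρ θ₀ G₂ i j - ∫ x, f i j x ∂G₂ := by
      rw [mul_matA_apply hρ, ← integral_sub (H.integrable_entry i j) (hfi H.int_deriv₂ i j)]
      congr 1; funext x; simp only [hf, sigmoidDeriv, smul_eq_mul]; ring
    rw [h2, h1, h3, matS, Matrix.smul_apply, smul_eq_mul, smul_eq_mul]
    field_simp
    ring
  have hae : ∀ᵐ ω ∂P, Tendsto (fun k => hessianDev h ρ θ₀ G₂ (n₁ k) (n₂ k)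
      (fun j => X₁ j ω) (fun j => X₂ j ω)) atTop (𝓝 0) := by
    have a₁ : ∀ᵐ ω ∂P, ∀ i j, _ := ae_all_iff.2 fun i => ae_all_iff.2 fun j =>
      ae_tendsto_avg hX₁ (iIndepFun_left hindep) (hfm i j) (hfi H.int_deriv₁ i j) hn₁ hp₁
    have a₂ : ∀ᵐ ω ∂P, ∀ i j, _ := ae_all_iff.2 fun i => ae_all_iff.2 fun j =>
      ae_tendsto_avg hX₂ (iIndepFun_right hindep) (hfm i j) (hfi H.int_deriv₂ i j) hn₂ hp₂
    filter_upwards [a₁, a₂] with ω h₁ h₂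
    have h3 : Tendsto (fun k => hessianDev h ρ θ₀ G₂ (n₁ k) (n₂ k)
      (fun j => X₁ j ω) (fun j => X₂ j ω)) atTop
      (𝓝 (∑ i, ∑ j, |matS h ρ θ₀ G₂ i j - matS h ρ θ₀ G₂ i j|)) := by
      refine tendsto_finsetSum _ fun i _ => tendsto_finsetSum _ fun j _ => ?_
      refine Tendsto.abs (Tendsto.sub_const ?_ _)
      rw [← hval i j]
      simp only [sampleSum, mul_add]
      exact (h₁ i j).add (h₂ i j)
    simpa using h3
  refine tendstoInMeasure_of_tendsto_ae (fun k => ?_) hae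
  have hfc₁ : ∀ i j l, AEMeasurable (fun ω => f i j (X₁ l ω)) P := fun i j l =>
    (hfm i j).comp_aemeasurable (hX₁ l).aemeasurable
  have hfc₂ : ∀ i j l, AEMeasurable (fun ω => f i j (X₂ l ω)) P := fun i j l =>
    (hfm i j).comp_aemeasurable (hX₂ l).aemeasurable
  refine AEMeasurable.aestronglyMeasurable ?_
  refine Finset.aemeasurable_fun_sum _ fun i _ => Finset.aemeasurable_fun_sum _ fun j _ => ?_
  refine AEMeasurable.abs (((AEMeasurable.add (Finset.aemeasurable_fun_sum _ fun l _ => hfc₁ i j l)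
    (Finset.aemeasurable_fun_sum _ fun l _ => hfc₂ i j l)).const_mul _).sub_const _)

end Remainders

section Localization

variable {𝒳 : Type*} [MeasurableSpace 𝒳] {d : ℕ} {h : 𝒳 → Fin d → ℝ} {θ₀ : Param d}
  {G₁ G₂ : Measure 𝒳} {ρ : ℝ}

lemma mul_exp_div_sq_eq (hρ : 0 < ρ) (s : ℝ) :
    ρ * Real.exp s / (1 + ρ * Real.exp s) ^ 2 = sigmoidDeriv (s + Real.log ρ) := by
  rw [sigmoidDeriv_eq, ← exp_mul_add_log hρ]

/-- If the empirical Hessian is close to `S`, then the design vectors span. -/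
lemma eq_zero_of_forall_inner_eq_zero {κ : ℝ}
    (hκ : ∀ t : Param d,
      κ * ‖t‖ ^ 2 ≤ inner ℝ t (Matrix.toEuclideanCLM (𝕜 := ℝ) (matS h ρ θ₀ G₂) t))
    {m₁ m₂ : ℕ} {x₁ x₂ : ℕ → 𝒳} (hdev : hessianDev h ρ θ₀ G₂ m₁ m₂ x₁ x₂ < κ) {w : Param d}
    (hw₁ : ∀ j < m₁, inner ℝ w (design h (x₁ j)) = 0)
    (hw₂ : ∀ j < m₂, inner ℝ w (design h (x₂ j)) = 0) : w = 0 := by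
  have h1 := abs_hessian_sub_le (h := h) (θ₀ := θ₀) (ρ := ρ) (G₂ := G₂) m₁ m₂ x₁ x₂ w
  have h2 : sampleSum
      (fun x => sigmoidDeriv (linPred h θ₀ x + Real.log ρ) * inner ℝ w (design h x) ^ 2)
      (fun x => sigmoidDeriv (linPred h θ₀ x + Real.log ρ) * inner ℝ w (design h x) ^ 2)
      m₁ m₂ x₁ x₂ = 0 := by
    rw [sampleSum, Finset.sum_eq_zero, Finset.sum_eq_zero, add_zero]
    · intro j hj; rw [hw₂ j (Finset.mem_range.1 hj)]; ring
    · intro j hj; rw [hw₁ j (Finset.mem_range.1 hj)]; ring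
  rw [h2, mul_zero, zero_sub, abs_neg] at h1
  have h3 := (hκ w).trans ((le_abs_self _).trans h1)
  by_contra hne
  have h4 : 0 < ‖w‖ ^ 2 := by have := norm_pos_iff.2 hne; positivity
  nlinarith

/-- Deterministic localization of the maximizers of the penalized log-likelihood. -/
lemma localization {q lam lam₀ κ ε R r δ η : ℝ} (hq : 1 < q) (hlam : 0 ≤ lam)
    (hS : (matS h ρ θ₀ G₂).IsHermitian)
    (hκ : ∀ t : Param d,
      κ * ‖t‖ ^ 2 ≤ inner ℝ t (Matrix.toEuclideanCLM (𝕜 := ℝ) (matS h ρ θ₀ G₂) t))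
    {K : 𝒳 → ℝ} (hK : ∀ θ ∈ Metric.ball θ₀ r, ∀ x,
      sigmoidDeriv (linPred h θ x + Real.log ρ) * ‖design h x‖ ^ 2 ≤ K x)
    (hK0 : ∀ x, 0 ≤ K x)
    {m₁ m₂ : ℕ} (h₁ : 0 < m₁) (h₂ : 0 < m₂) {x₁ x₂ : ℕ → 𝒳} {a b : Param d} (hε : 0 < ε)
    (ha : Matrix.toEuclideanCLM (𝕜 := ℝ) (matS h ρ θ₀ G₂) a =
      (√((m₁ + m₂ : ℕ) : ℝ))⁻¹ • score h θ₀ (Real.log (m₁ / m₂)) m₁ m₂ x₁ x₂ - lam₀ • b)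
    (haR : ‖a‖ + ε ≤ R) (hδ : δ < r)
    (hδR : |Real.log (m₁ / m₂) - Real.log ρ| + (√((m₁ + m₂ : ℕ) : ℝ))⁻¹ * R ≤ δ)
    (hpen : ∀ u : Param d, ‖u‖ ≤ R →
      |lam * (bridgePenalty q (θ₀ + (√((m₁ + m₂ : ℕ) : ℝ))⁻¹ • u) - bridgePenalty q θ₀)
        - lam₀ * inner ℝ u b| ≤ η)
    (hdev : hessianDev h ρ θ₀ G₂ m₁ m₂ x₁ x₂ < κ)
    (hsmall : R ^ 2 * (((m₁ + m₂ : ℕ) : ℝ)⁻¹ *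
        sampleSum (hessianModulus h K δ) (hessianModulus h K δ) m₁ m₂ x₁ x₂)
      + R ^ 2 * hessianDev h ρ θ₀ G₂ m₁ m₂ x₁ x₂ / 2 + η < κ * ε ^ 2 / 4) :
    (∃! θ, IsPenMaximizer h q lam m₁ m₂ x₁ x₂ θ) ∧
      ∀ θ, IsPenMaximizer h q lam m₁ m₂ x₁ x₂ θ →
        ‖√((m₁ + m₂ : ℕ) : ℝ) • (θ - θ₀) - a‖ < ε := by
  set N : ℝ := ((m₁ + m₂ : ℕ) : ℝ) with hN
  have hNpos : 0 < N := by rw [hN]; exact_mod_cast Nat.add_pos_left h₁ m₂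
  set s : ℝ := (√N)⁻¹ with hs
  have hsq : 0 < √N := Real.sqrt_pos.2 hNpos
  have hspos : 0 < s := inv_pos.2 hsq
  have hs2 : s ^ 2 = N⁻¹ := by rw [hs, inv_pow, Real.sq_sqrt hNpos.le]
  set T := Matrix.toEuclideanCLM (𝕜 := ℝ) (matS h ρ θ₀ G₂) with hT
  set U := score h θ₀ (Real.log (m₁ / m₂)) m₁ m₂ x₁ x₂ with hU
  set Dn := N⁻¹ * sampleSum (hessianModulus h K δ) (hessianModulus h K δ) m₁ m₂ x₁ x₂ with hDn
  set Hn := hessianDev h ρ θ₀ G₂ m₁ m₂ x₁ x₂ with hHn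
  have hR0 : 0 ≤ R := le_trans (by positivity) haR
  have hδ0 : 0 ≤ δ := le_trans (by positivity) hδR
  have hDn0 : 0 ≤ Dn := mul_nonneg (inv_nonneg.2 hNpos.le) (add_nonneg
    (Finset.sum_nonneg fun j _ => hessianModulus_nonneg hK0 hδ0 _)
    (Finset.sum_nonneg fun j _ => hessianModulus_nonneg hK0 hδ0 _))
  have hHn0 : 0 ≤ Hn := Finset.sum_nonneg fun i _ => Finset.sum_nonneg fun j _ => abs_nonneg _
  set f : Param d → ℝ := fun u => penLogLik h q lam m₁ m₂ x₁ x₂ (θ₀ + s • u) with hf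
  have hfconc : ConcaveOn ℝ Set.univ f := by
    refine ⟨convex_univ, fun u _ v _ α β hα hβ hαβ => ?_⟩
    have h1 := (concaveOn_penLogLik (h := h) hq hlam h₁ h₂ x₁ x₂).2 (Set.mem_univ (θ₀ + s • u))
      (Set.mem_univ (θ₀ + s • v)) hα hβ hαβ
    have h2 : α • (θ₀ + s • u) + β • (θ₀ + s • v) = θ₀ + s • (α • u + β • v) := by
      have h3 : θ₀ = (α + β) • θ₀ := by rw [hαβ, one_smul]
      conv_rhs => rw [h3]
      module
    rwa [h2] at h1
  have hfcont : Continuous f :=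
    (continuous_penLogLik (h := h) hq lam h₁ h₂ x₁ x₂).comp (by fun_prop)
  have hexp : ∀ u : Param d, ‖u‖ ≤ R →
      |f u - f 0 - (inner ℝ u (T a) - inner ℝ u (T u) / 2)| ≤ R ^ 2 * Dn + R ^ 2 * Hn / 2 + η := by
    intro u hu
    have e₁ := abs_empLogLik_expansion_le hK h₁ h₂ x₁ x₂ hδ hspos.le (u := u)
      (le_trans (by gcongr) hδR)
    have e₂ := abs_hessian_sub_le (h := h) (θ₀ := θ₀) (ρ := ρ) (G₂ := G₂) m₁ m₂ x₁ x₂ u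
    have e₃ := hpen u hu
    rw [hs2] at e₁
    have hu2 : ‖u‖ ^ 2 ≤ R ^ 2 := by gcongr
    have b₁ : N⁻¹ * ‖u‖ ^ 2 * sampleSum (hessianModulus h K δ) (hessianModulus h K δ) m₁ m₂ x₁ x₂
        ≤ R ^ 2 * Dn := by
      calc _ = ‖u‖ ^ 2 * Dn := by rw [hDn]; ring
        _ ≤ _ := by gcongr
    have b₂ : ‖u‖ ^ 2 * Hn ≤ R ^ 2 * Hn := by gcongr
    rw [ha, inner_sub_right, real_inner_smul_right, real_inner_smul_right]
    simp only [hf, penLogLik, smul_zero, add_zero]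
    rw [abs_le] at e₁ e₂ e₃ ⊢
    constructor <;> linarith [e₁.1, e₁.2, e₂.1, e₂.2, e₃.1, e₃.2]
  have hlt : ∀ u, ‖u - a‖ = ε → f u < f a := by
    intro u hu
    have huR : ‖u‖ ≤ R := by
      calc ‖u‖ = ‖(u - a) + a‖ := by rw [sub_add_cancel]
        _ ≤ ‖u - a‖ + ‖a‖ := norm_add_le _ _
        _ ≤ R := by rw [hu]; linarith
    have e₁ := abs_le.1 (hexp u huR)
    have e₂ := abs_le.1 (hexp a (by linarith))
    have e₃ := hκ (u - a)
    rw [hu, map_sub, inner_sub_left, inner_sub_right, inner_sub_right] at e₃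
    have hsymm : inner ℝ a (T u) = inner ℝ u (T a) := by
      rw [inner_toEuclideanCLM_comm hS, real_inner_comm]
    rw [hsymm] at e₃
    linarith [e₁.1, e₁.2, e₂.1, e₂.2]
  obtain ⟨⟨u, hu⟩, hball⟩ := exists_max_of_lt_on_sphere hfconc hfcont hε hlt
  have hback : ∀ θ : Param d, θ₀ + s • (√N • (θ - θ₀)) = θ := fun θ => by
    rw [smul_smul, hs, inv_mul_cancel₀ hsq.ne', one_smul, add_sub_cancel]
  refine ⟨⟨θ₀ + s • u, fun θ => ?_, fun θ hθ => ?_⟩, fun θ hθ => hball _ fun v => ?_⟩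
  · have := hu (√N • (θ - θ₀))
    simpa only [hf, hback] using this
  · refine IsPenMaximizer.eq hq hlam h₁ h₂ (fun w => eq_zero_of_forall_inner_eq_zero hκ hdev) hθ
      fun θ' => ?_
    have := hu (√N • (θ' - θ₀))
    simpa only [hf, hback] using this
  · simpa only [hf, hback] using hθ (θ₀ + s • v)

variable {Ω : Type*} [MeasurableSpace Ω] {P : Measure Ω} [IsProbabilityMeasure P]
  [IsProbabilityMeasure G₁] [IsProbabilityMeasure G₂] {X₁ X₂ : ℕ → Ω → 𝒳} {n₁ n₂ : ℕ → ℕ}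

/-- A sequence that converges in distribution is tight. -/
lemma exists_measure_norm_gt_le {E Ω' : Type*} [NormedAddCommGroup E] [InnerProductSpace ℝ E]
    [FiniteDimensional ℝ E] [MeasurableSpace E] [BorelSpace E] [MeasurableSpace Ω']
    {Q : Measure Ω'} [IsProbabilityMeasure Q] {W : ℕ → Ω → E} {Z : Ω' → E}
    (hW : TendstoInDistribution W atTop Z (fun _ => P) Q) {η : ENNReal} (hη : 0 < η) :
    ∃ M : ℝ, 0 ≤ M ∧ ∀ k, P {ω | M < ‖W k ω‖} ≤ η := by
  have h1 := ProbabilityMeasure.tendsto_iff_tendsto_charFun.1 hW.tendsto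
  have : ∀ k, IsProbabilityMeasure (P.map (W k)) := fun k =>
    Measure.isProbabilityMeasure_map (hW.forall_aemeasurable k)
  have := Measure.isProbabilityMeasure_map (μ := Q) hW.aemeasurable_limit
  have h2 := isTightMeasureSet_of_tendsto_charFun (μ := fun k => P.map (W k))
    (f := charFun (Q.map Z)) (by fun_prop) h1
  obtain ⟨K, hK, hKle⟩ := isTightMeasureSet_iff_exists_isCompact_measure_compl_le.1 h2 η hη
  obtain ⟨M, hM⟩ := hK.isBounded.subset_closedBall 0
  refine ⟨max M 0, le_max_right _ _, fun k => ?_⟩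
  refine le_trans ?_ (hKle _ ⟨k, rfl⟩)
  rw [Measure.map_apply_of_aemeasurable (hW.forall_aemeasurable k) hK.isClosed.measurableSet.compl]
  refine measure_mono fun ω hω hmem => ?_
  have := hM hmem
  rw [mem_closedBall_zero_iff] at this
  exact absurd (this.trans (le_max_left M 0)) (not_le.2 hω)

/-- With probability tending to one the penalized log-likelihood has a unique maximizer, and it
is close to the maximizer of the limiting quadratic form. -/
lemma SigmoidMoments.tendsto_measure_localization (H : SigmoidMoments h θ₀ ρ G₁ G₂)
    (hA : IsUnit (matA h ρ θ₀ G₂))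
    {r : ℝ} (hr : 0 < r) {K : 𝒳 → ℝ} (hK₁ : Integrable K G₁) (hK₂ : Integrable K G₂)
    (hK : ∀ θ ∈ Metric.ball θ₀ r, ∀ x,
      sigmoidDeriv (linPred h θ x + Real.log ρ) * ‖design h x‖ ^ 2 ≤ K x)
    (hX₁ : ∀ j, HasLaw (X₁ j) G₁ P) (hX₂ : ∀ j, HasLaw (X₂ j) G₂ P)
    (hindep : iIndepFun (fun s : ℕ ⊕ ℕ => Sum.elim X₁ X₂ s) P)
    (hn : Tendsto (fun k => n₁ k + n₂ k) atTop atTop)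
    (hratio : Tendsto (fun k => (n₁ k : ℝ) / (n₂ k : ℝ)) atTop (𝓝 ρ))
    {q : ℝ} (hq : 1 < q) {lam : ℕ → ℝ} (hlam0 : ∀ k, 0 ≤ lam k) {lam₀ : ℝ}
    (hlam : Tendsto (fun k => lam k / √((n₁ k + n₂ k : ℕ) : ℝ)) atTop (𝓝 lam₀))
    {ε : ℝ} (hε : 0 < ε) :
    Tendsto (fun k => P {ω | ¬ ((∃! θ, IsPenMaximizer h q (lam k) (n₁ k) (n₂ k)
          (fun j => X₁ j ω) (fun j => X₂ j ω) θ) ∧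
        ∀ θ, IsPenMaximizer h q (lam k) (n₁ k) (n₂ k) (fun j => X₁ j ω) (fun j => X₂ j ω) θ →
          ‖√((n₁ k + n₂ k : ℕ) : ℝ) • (θ - θ₀)
            - ((√((n₁ k + n₂ k : ℕ) : ℝ))⁻¹ • Matrix.toEuclideanCLM (𝕜 := ℝ) (matS h ρ θ₀ G₂)⁻¹
              (score h θ₀ (Real.log (n₁ k / n₂ k)) (n₁ k) (n₂ k)
                (fun j => X₁ j ω) (fun j => X₂ j ω))
              - lam₀ • Matrix.toEuclideanCLM (𝕜 := ℝ) (matS h ρ θ₀ G₂)⁻¹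
                (gradient (bridgePenalty q) θ₀))‖ < ε)}) atTop (𝓝 0) := by
  obtain ⟨hn₁, hn₂, -, -⟩ := tendsto_sampleSize H.pos hn hratio
  have hSpd := H.posDef_matS hA
  obtain ⟨κ, hκ0, hκ⟩ := exists_pos_mul_sq_le_of_posDef hSpd
  have hK0 : ∀ x, 0 ≤ K x := fun x =>
    le_trans (by have := sigmoidDeriv_pos (linPred h θ₀ x + Real.log ρ); positivity)
      (hK θ₀ (Metric.mem_ball_self hr) x)
  set L := Matrix.toEuclideanCLM (𝕜 := ℝ) (matS h ρ θ₀ G₂)⁻¹ with hL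
  set b := gradient (bridgePenalty q) θ₀ with hb
  have hclt := H.tendstoInDistribution_score hA hX₁ hX₂ hindep hn hratio
  have hN : Tendsto (fun k => ((n₁ k + n₂ k : ℕ) : ℝ)) atTop atTop :=
    tendsto_natCast_atTop_atTop.comp hn
  have hs : Tendsto (fun k => (√((n₁ k + n₂ k : ℕ) : ℝ))⁻¹) atTop (𝓝 0) :=
    tendsto_inv_atTop_zero.comp (Real.tendsto_sqrt_atTop.comp hN)
  have hlog : Tendsto (fun k => |Real.log (n₁ k / n₂ k) - Real.log ρ|) atTop (𝓝 0) := by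
    have := (((Real.continuousAt_log H.pos.ne').tendsto.comp hratio).sub_const (Real.log ρ)).abs
    simpa using this
  rw [ENNReal.tendsto_nhds_zero]
  intro c hc
  have hc3 : 0 < c / 3 := ENNReal.div_pos hc.ne' (by norm_num)
  obtain ⟨M, hM0, hM⟩ := exists_measure_norm_gt_le hclt hc3
  set R := M + ‖lam₀ • L b‖ + ε with hR
  set e₀ := κ * ε ^ 2 / (16 * (R ^ 2 + 1)) with he₀
  have he₀pos : 0 < e₀ := by positivity
  have hRe₀ : R ^ 2 * e₀ ≤ κ * ε ^ 2 / 16 := by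
    rw [he₀, mul_div_assoc', div_le_div_iff₀ (by positivity) (by positivity)]
    have : 0 < κ * ε ^ 2 := by positivity
    nlinarith
  set δ : ℕ → ℝ := fun k => |Real.log (n₁ k / n₂ k) - Real.log ρ|
    + (√((n₁ k + n₂ k : ℕ) : ℝ))⁻¹ * R with hδ
  have hδ0 : ∀ k, 0 ≤ δ k := fun k => by positivity
  have hδlim : Tendsto δ atTop (𝓝 0) := by
    simpa only [zero_mul, add_zero] using hlog.add (hs.mul_const R)
  have hpen := eventually_abs_penalty_expansion_le (differentiable_bridgePenalty hq θ₀) hs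
    (fun k => by positivity) hlam0 (by simpa only [div_eq_mul_inv] using hlam) R
    (η := κ * ε ^ 2 / 16) (by positivity)
  have hD := ENNReal.tendsto_nhds_zero.1 (tendstoInMeasure_iff_norm.1
    (tendstoInMeasure_hessianModulus (n₁ := n₁) (n₂ := n₂) H.meas hX₁ hX₂ hK₁ hK₂ hK0 hδ0 hδlim)
    e₀ he₀pos) _ hc3
  have hdev := ENNReal.tendsto_nhds_zero.1 (tendstoInMeasure_iff_norm.1
    (H.tendstoInMeasure_hessianDev hX₁ hX₂ hindep hn hratio) (min e₀ κ) (lt_min he₀pos hκ0)) _ hc3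
  filter_upwards [hpen, hD, hdev, hδlim.eventually_lt_const hr, hn₁.eventually_gt_atTop 0,
    hn₂.eventually_gt_atTop 0] with k hpen hD hdev hδr h₁ h₂
  refine (measure_mono fun ω hω => ?_).trans ((measure_union_le _ _).trans
    ((add_le_add ((measure_union_le _ _).trans (add_le_add (hM k) hD)) hdev).trans
      (ENNReal.add_thirds c).le))
  by_contra hbad
  refine hω ?_
  simp only [Set.mem_union, Set.mem_ofPred_eq, not_or, not_lt, not_le, Pi.zero_apply,
    sub_zero] at hbad
  obtain ⟨⟨hW, hDω⟩, hdevω⟩ := hbad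
  obtain ⟨hdev₁, hdev₂⟩ := lt_min_iff.1 ((le_abs_self _).trans_lt hdevω)
  have hDω' := (le_abs_self _).trans_lt hDω
  refine localization hq (hlam0 k) hSpd.isHermitian hκ hK hK0 h₁ h₂ hε ?_ (R := R) ?_ hδr le_rfl
    hpen hdev₂ ?_
  · rw [map_sub, map_smul, map_smul, hL, H.matS_inv_apply hA, H.matS_inv_apply hA]
  · rw [hR]
    linarith [norm_sub_le ((√((n₁ k + n₂ k : ℕ) : ℝ))⁻¹ • L (score h θ₀ (Real.log (n₁ k / n₂ k))
      (n₁ k) (n₂ k) (fun j => X₁ j ω) (fun j => X₂ j ω))) (lam₀ • L b)]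
  · have g₁ := (mul_le_mul_of_nonneg_left hDω'.le (sq_nonneg R)).trans hRe₀
    have g₂ := (mul_le_mul_of_nonneg_left hdev₁.le (sq_nonneg R)).trans hRe₀
    have : 0 < κ * ε ^ 2 := by positivity
    linarith

end Localization

end DensityRatio

end

theorem theorem3p2
    {Ω : Type*} [MeasurableSpace Ω] (P : Measure Ω) [IsProbabilityMeasure P]
    {𝒳 : Type*} [MeasurableSpace 𝒳]
    (G₁ G₂ : Measure 𝒳) [IsProbabilityMeasure G₁] [IsProbabilityMeasure G₂]
    {d : ℕ} (h : 𝒳 → Fin d → ℝ) (hh : Measurable h)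
    (θ₀ : DensityRatio.Param d)
    -- the density ratio model holds with true parameter `θ₀`
    (hmodel : DensityRatio.DensityRatioModel h θ₀ G₁ G₂)
    -- two independent random samples, from `G₁` and from `G₂`
    (X₁ X₂ : ℕ → Ω → 𝒳)
    (hX₁ : ∀ j, HasLaw (X₁ j) G₁ P) (hX₂ : ∀ j, HasLaw (X₂ j) G₂ P)
    (hindep : iIndepFun (fun s : ℕ ⊕ ℕ => Sum.elim X₁ X₂ s) P)
    -- sample sizes: the total tends to infinity and the ratio tends to `ρ₁`
    (n₁ n₂ : ℕ → ℕ) (ρ₁ : ℝ) (hρ₁ : 0 < ρ₁)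
    (hn : Tendsto (fun k => n₁ k + n₂ k) atTop atTop)
    (hratio : Tendsto (fun k => (n₁ k : ℝ) / (n₂ k : ℝ)) atTop (𝓝 ρ₁))
    -- regularity conditions
    (hreg : DensityRatio.DominatedHessian h ρ₁ θ₀ G₁ G₂)
    (hA : IsUnit (DensityRatio.matA h ρ₁ θ₀ G₂))
    -- penalty and regularization parameters
    (q : ℝ) (hq : 1 < q)
    (lam : ℕ → ℝ) (hlam_nonneg : ∀ k, 0 ≤ lam k) (lam₀ : ℝ)
    (hlam : Tendsto (fun k => lam k / √((n₁ k + n₂ k : ℕ) : ℝ)) atTop (𝓝 lam₀)) :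
    -- the limiting covariance matrix is a covariance matrix
    (DensityRatio.asympCov h ρ₁ θ₀ G₂).PosSemidef ∧
    -- with probability tending to one there is a unique maximizer
    Tendsto (fun k => P {ω | ¬ ∃! θ : DensityRatio.Param d,
        DensityRatio.IsPenMaximizer h q (lam k) (n₁ k) (n₂ k)
          (fun j => X₁ j ω) (fun j => X₂ j ω) θ}) atTop (𝓝 0) ∧
    -- and the estimator is asymptotically normal
    ∀ θhat : ℕ → Ω → DensityRatio.Param d,
      (∀ k, AEMeasurable (θhat k) P) →
      Tendsto (fun k => P {ω | ¬ DensityRatio.IsPenMaximizer h q (lam k) (n₁ k) (n₂ k)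
          (fun j => X₁ j ω) (fun j => X₂ j ω) (θhat k ω)}) atTop (𝓝 0) →
      TendstoInDistribution
        (fun (k : ℕ) (ω : Ω) =>
          √((n₁ k + n₂ k : ℕ) : ℝ) • (θhat k ω - θ₀)
            + lam₀ • Matrix.toEuclideanLin (DensityRatio.matS h ρ₁ θ₀ G₂)⁻¹
                (gradient (DensityRatio.bridgePenalty q) θ₀))
        atTop id (fun _ => P)
        (multivariateGaussian (0 : DensityRatio.Param d) (DensityRatio.asympCov h ρ₁ θ₀ G₂)) ∧
      (lam₀ = 0 →
        TendstoInDistribution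
          (fun (k : ℕ) (ω : Ω) => √((n₁ k + n₂ k : ℕ) : ℝ) • (θhat k ω - θ₀))
          atTop id (fun _ => P)
          (multivariateGaussian (0 : DensityRatio.Param d)
            (DensityRatio.asympCov h ρ₁ θ₀ G₂))) := by
  obtain ⟨r, hr, K, hK₁, hK₂, hKle⟩ := hreg
  have hK : ∀ θ ∈ Metric.ball θ₀ r, ∀ x, DensityRatio.sigmoidDeriv
      (DensityRatio.linPred h θ x + Real.log ρ₁) * ‖DensityRatio.design h x‖ ^ 2 ≤ K x :=
    fun θ hθ x => by
      rw [← DensityRatio.mul_exp_div_sq_eq hρ₁]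
      exact hKle θ hθ x
  have hint : ∀ {G : Measure 𝒳}, Integrable K G → Integrable (fun x => DensityRatio.sigmoidDeriv
      (DensityRatio.linPred h θ₀ x + Real.log ρ₁) * ‖DensityRatio.design h x‖ ^ 2) G := fun hG =>
    hG.mono' ((DensityRatio.measurable_sigmoidDeriv_linPred hh θ₀ _).mul
      ((DensityRatio.measurable_design hh).norm.pow_const 2)).aestronglyMeasurable
      (ae_of_all _ fun x => by
        rw [Real.norm_of_nonneg (mul_nonneg (DensityRatio.sigmoidDeriv_pos _).le (sq_nonneg _))]
        exact hK θ₀ (Metric.mem_ball_self hr) x)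
  have H : DensityRatio.SigmoidMoments h θ₀ ρ₁ G₁ G₂ := ⟨hmodel, hh, hρ₁, hint hK₁, hint hK₂⟩
  have hloc := fun (ε : ℝ) (hε : 0 < ε) => H.tendsto_measure_localization hA hr hK₁ hK₂ hK hX₁ hX₂
    hindep hn hratio hq hlam_nonneg hlam hε
  refine ⟨H.posSemidef_asympCov hA, ?_, fun θhat hθm hθmax => ?_⟩
  · refine tendsto_of_tendsto_of_tendsto_of_le_of_le tendsto_const_nhds (hloc 1 one_pos)
      (fun _ => zero_le) fun k => measure_mono fun ω hω hω' => hω hω'.1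
  have hdist : TendstoInDistribution
      (fun (k : ℕ) (ω : Ω) => √((n₁ k + n₂ k : ℕ) : ℝ) • (θhat k ω - θ₀)
        + lam₀ • Matrix.toEuclideanLin (DensityRatio.matS h ρ₁ θ₀ G₂)⁻¹
          (gradient (DensityRatio.bridgePenalty q) θ₀))
      atTop id (fun _ => P)
      (multivariateGaussian (0 : DensityRatio.Param d) (DensityRatio.asympCov h ρ₁ θ₀ G₂)) := by
    refine tendstoInDistribution_of_tendstoInMeasure_sub _ _
      (H.tendstoInDistribution_score hA hX₁ hX₂ hindep hn hratio) ?_ fun k => by fun_prop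
    rw [tendstoInMeasure_iff_norm]
    intro ε hε
    refine tendsto_of_tendsto_of_tendsto_of_le_of_le tendsto_const_nhds
      (by simpa only [add_zero] using (hloc ε hε).add hθmax) (fun _ => zero_le) fun k =>
        (measure_mono fun ω hω => ?_).trans (measure_union_le _ _)
    by_contra hbad
    rw [Set.mem_union, not_or] at hbad
    have hlt := (not_not.1 hbad.1).2 _ (not_not.1 hbad.2)
    rw [Set.mem_ofPred_eq] at hω
    refine absurd hω (not_le.2 ?_)
    simp only [Pi.sub_apply, Pi.zero_apply, sub_zero]
    refine lt_of_eq_of_lt (congrArg _ ?_) hlt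
    rw [← Matrix.coe_toEuclideanCLM_eq_toEuclideanLin]
    simp only [ContinuousLinearMap.coe_coe]
    abel
  exact ⟨hdist, fun h0 => by simpa only [h0, zero_smul, add_zero] using hdist⟩
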